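/- Let $n\ge 1$ be an integer. Let $\mathfrak P$ be the Banach space of $\theta\in C^2([0,1])$ with $\theta(0)=\theta(1)$, $\theta'(0)=\theta'(1)$, $\theta''(0)=\theta''(1)$, with norm $\|\theta\|=\sup_{r\in[0,1]}(|\theta(r)|+|\theta'(r)|+|\theta''(r)|)$, and write $\mathfrak B(\theta_0,\rho)=\{\theta\in\mathfrak P:\|\theta-\theta_0\|\le\rho\}$. Let $\mathfrak P^+=\{f\in\mathfrak P:\min_{[0,1]}f>0\}$, and for $f\in\mathfrak P^+$ let $\mathfrak P_c(f)$ be the set of $\kappa\in\mathfrak P$ for which the operator $L_{f,\kappa}v=-v''-n\frac{f'}{f}v'+\kappa v$ with periodic boundary conditions is coercive, i.e. for some $c>0$ $$\int_0^1 f^n\,(v'^2+\kappa v^2)\,dr\ \ge\ c\int_0^1(v'^2+v^2)\,dr\qquad\text{for all } v\in W^{1,2}(0,1) \text{ with } v(0)=v(1).$$ For $f\in\mathfrak P^+$, $\kappa\in\mathfrak P_c(f)$ let $G_{f,\kappa}$ be the Green's function of $L_{f,\kappa}$ with periodic boundary conditions: the continuous function on $[0,1]^2$ such that for every smooth $h$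 the function $v(r)=\int_0^1G_{f,\kappa}(r,s)h(s)\,ds$ is the unique $C^2([0,1])$ solution of $L_{f,\kappa}v=h$ in $(0,1)$, $v(0)=v(1)$, $v'(0)=v'(1)$. Let $\Gamma_f(r,s)=0$ for $r\le s$ and $\Gamma_f(r,s)=-f^n(s)\int_s^r f^{-n}(t)\,dt$ for $s<r$, let $H_{f,\kappa}=G_{f,\kappa}-\Gamma_f$, and set $$\mathcal V_{f,\kappa}(r)=\frac{H_{f,\kappa}(r,r)}{f^n(r)},\qquad r\in[0,1].$$ A critical point $r\in[0,1]$ of $\mathcal V_{f,\kappa}$ (a point with $\mathcal V_{f,\kappa}'(r)=0$; derivatives are one-sided at $0$ and $1$) is non-degenerate if $\mathcal V_{f,\kappa}''(r)\neq0$. (i) Let $f_0\in\mathfrak P^+$ and $\kappa\in\mathfrak P_c(f_0)$. There is $\rho_0>0$ such that for every $0<\rho\le\rho_0$: every $f\in\mathfrak B(f_0,\rho)$ satisfies $f\in\mathfrak P^+$ and $\kappa\in\mathfrak P_c(f)$, the Green's function $G_{f,\kappa}$ exists, $\mathcal V_{f,\kappa}\in C^2([0,1])$, and the set of $f\in\mathfrak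 B(f_0,\rho)$ such that all critical points of $\mathcal V_{f,\kappa}$ are non-degenerate is dense in $\mathfrak B(f_0,\rho)$. (ii) Let $f\in\mathfrak P^+$ and $\kappa_0\in\mathfrak P_c(f)$. There is $\rho_0>0$ such that for every $0<\rho\le\rho_0$: every $\kappa\in\mathfrak B(\kappa_0,\rho)$ satisfies $\kappa\in\mathfrak P_c(f)$, the Green's function $G_{f,\kappa}$ exists, $\mathcal V_{f,\kappa}\in C^2([0,1])$, and the set of $\kappa\in\mathfrak B(\kappa_0,\rho)$ such that all critical points of $\mathcal V_{f,\kappa}$ are non-degenerate is dense in $\mathfrak B(\kappa_0,\rho)$. -/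

import Mathlib

open Set MeasureTheory
open scoped ContDiff

noncomputable section

namespace WarpedGreen

/-- The space of `C²` functions on `[0,1]` whose values and first two derivatives agree at `0` and
`1`. Each such function is identified with its 1-periodic extension, so the elements are the
`C²` functions `ℝ → ℝ` of period `1`. -/
def periodicC2 : Submodule ℝ (ℝ → ℝ) where
  carrier := {θ | ContDiff ℝ 2 θ ∧ Function.Periodic θ 1}
  zero_mem' := ⟨contDiff_const, fun _ => rfl⟩
  add_mem' h₁ h₂ := ⟨h₁.1.add h₂.1, h₁.2.add h₂.2⟩
  smul_mem' c _ h := ⟨contDiff_const.smul h.1, fun x => congrArg (c • ·) (h.2 x)⟩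

/-- The type of elements of `periodicC2`; it will carry the `C²` norm (and not the topology of
pointwise convergence that it would inherit as a subtype of `ℝ → ℝ`). -/
def PerC2 : Type := ↥periodicC2

namespace PerC2

instance : AddCommGroup PerC2 := inferInstanceAs (AddCommGroup ↥periodicC2)

instance : Module ℝ PerC2 := inferInstanceAs (Module ℝ ↥periodicC2)

instance : CoeFun PerC2 (fun _ => ℝ → ℝ) := ⟨fun θ => θ.1⟩

theorem contDiff (θ : PerC2) : ContDiff ℝ 2 θ := θ.2.1

theorem periodic (θ : PerC2) : Function.Periodic θ 1 := θ.2.2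

/-- `|θ(r)| + |θ'(r)| + |θ''(r)|`. -/
def jet (θ : PerC2) (r : ℝ) : ℝ := |θ r| + |deriv θ r| + |deriv (deriv θ) r|

/-- The norm `sup_{r ∈ [0,1]} (|θ(r)| + |θ'(r)| + |θ''(r)|)`. -/
instance : Norm PerC2 := ⟨fun θ => ⨆ r : Icc (0 : ℝ) 1, jet θ r⟩

theorem norm_def (θ : PerC2) : ‖θ‖ = ⨆ r : Icc (0 : ℝ) 1, jet θ r := rfl

theorem contDiff_deriv (θ : PerC2) : ContDiff ℝ 1 (deriv θ) :=
  (contDiff_succ_iff_deriv (n := 1)).1 θ.contDiff |>.2.2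

theorem continuous_jet (θ : PerC2) : Continuous (jet θ) :=
  (θ.contDiff.continuous.abs.add θ.contDiff_deriv.continuous.abs).add
    (θ.contDiff_deriv.continuous_deriv le_rfl).abs

theorem bddAbove_jet (θ : PerC2) : BddAbove (range fun r : Icc (0 : ℝ) 1 => jet θ r) :=
  isCompact_range (θ.continuous_jet.comp continuous_subtype_val) |>.bddAbove

theorem jet_nonneg (θ : PerC2) (r : ℝ) : 0 ≤ jet θ r := by unfold jet; positivity

theorem jet_le_norm (θ : PerC2) {r : ℝ} (hr : r ∈ Icc (0 : ℝ) 1) : jet θ r ≤ ‖θ‖ :=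
  le_ciSup θ.bddAbove_jet ⟨r, hr⟩

theorem deriv_add (θ η : PerC2) : deriv (θ + η : PerC2) = deriv θ + deriv η := by
  funext r
  exact _root_.deriv_add (θ.contDiff.differentiable two_ne_zero r)
    (η.contDiff.differentiable two_ne_zero r)

theorem deriv2_add (θ η : PerC2) (r : ℝ) :
    deriv (deriv (θ + η : PerC2)) r = deriv (deriv θ) r + deriv (deriv η) r := by
  rw [deriv_add]
  exact _root_.deriv_add (θ.contDiff_deriv.differentiable one_ne_zero r)
    (η.contDiff_deriv.differentiable one_ne_zero r)

theorem deriv_smul (c : ℝ) (θ : PerC2) : deriv (c • θ : PerC2) = fun r => c * deriv θ r := by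
  funext r
  exact deriv_const_mul c (θ.contDiff.differentiable two_ne_zero r)

theorem jet_smul (c : ℝ) (θ : PerC2) (r : ℝ) : jet (c • θ) r = |c| * jet θ r := by
  have h2 : deriv (deriv (c • θ : PerC2)) r = c * deriv (deriv θ) r := by
    rw [deriv_smul]
    exact deriv_const_mul c (θ.contDiff_deriv.differentiable one_ne_zero r)
  have h0 : (c • θ : PerC2) r = c * θ r := rfl
  unfold jet
  rw [h2, h0, deriv_smul, abs_mul, abs_mul, abs_mul]
  ring

theorem jet_add_le (θ η : PerC2) (r : ℝ) : jet (θ + η) r ≤ jet θ r + jet η r := by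
  have h0 : (θ + η : PerC2) r = θ r + η r := rfl
  have h1 : deriv (θ + η : PerC2) r = deriv θ r + deriv η r := congrFun (deriv_add θ η) r
  unfold jet
  rw [h0, h1, deriv2_add]
  linarith [abs_add_le (θ r) (η r), abs_add_le (deriv θ r) (deriv η r),
    abs_add_le (deriv (deriv θ) r) (deriv (deriv η) r)]

theorem normCore : NormedSpace.Core ℝ PerC2 where
  norm_nonneg θ := Real.iSup_nonneg fun r => θ.jet_nonneg r
  norm_smul c θ := by
    simp only [norm_def, jet_smul, Real.norm_eq_abs]
    exact (Real.mul_iSup_of_nonneg (abs_nonneg c) _).symm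
  norm_triangle θ η := by
    have : Nonempty (Icc (0 : ℝ) 1) := ⟨⟨0, by simp⟩⟩
    exact ciSup_le fun r => (jet_add_le θ η r).trans
      (add_le_add (θ.jet_le_norm r.2) (η.jet_le_norm r.2))
  norm_eq_zero_iff θ := by
    constructor
    · intro h
      apply Subtype.ext
      funext x
      obtain ⟨y, hy, hxy⟩ := θ.periodic.exists_mem_Ico₀ one_pos x
      have h0 : jet θ y ≤ 0 := (θ.jet_le_norm ⟨hy.1, hy.2.le⟩).trans_eq h
      have h1 : |θ y| ≤ 0 := le_trans
        (by unfold jet; linarith [abs_nonneg (deriv θ y), abs_nonneg (deriv (deriv θ) y)]) h0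
      exact hxy.trans (abs_nonpos_iff.1 h1)
    · rintro rfl
      have h : ∀ r, jet 0 r = 0 := fun r => by
        have := jet_smul 0 0 r
        simpa using this
      simp [norm_def, h]

instance : NormedAddCommGroup PerC2 := NormedAddCommGroup.ofCore normCore

instance : NormedSpace ℝ PerC2 := NormedSpace.ofCore normCore

end PerC2

/-- The positive elements: `min_{[0,1]} f > 0`. -/
def IsPositive (f : PerC2) : Prop := ∀ r ∈ Icc (0 : ℝ) 1, 0 < f r

/-- Coercivity of `v ↦ -v'' - n (f'/f) v' + κ v = -f⁻ⁿ (fⁿ v')' + κ v` with periodic boundary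
conditions: its quadratic form `∫₀¹ fⁿ (v'² + κ v²)` dominates a positive multiple of the squared
`W^{1,2}` norm on the periodic Sobolev space. An element of that space is given by its
continuous representative `v` and its weak derivative `w ∈ L²(0,1)`, so that
`v(x) = v(0) + ∫₀ˣ w` and `v(0) = v(1)`. -/
def IsCoercive (n : ℕ) (f κ : PerC2) : Prop :=
  ∃ c : ℝ, 0 < c ∧ ∀ v w : ℝ → ℝ,
    MemLp w 2 (volume.restrict (Icc (0 : ℝ) 1)) →
    (∀ x ∈ Icc (0 : ℝ) 1, v x = v 0 + ∫ t in (0 : ℝ)..x, w t) →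
    v 0 = v 1 →
    c * ∫ x in (0 : ℝ)..1, (w x ^ 2 + v x ^ 2) ≤
      ∫ x in (0 : ℝ)..1, f x ^ n * (w x ^ 2 + κ x * v x ^ 2)

/-- `v ∈ C²([0,1])` solves `-v'' - n (f'/f) v' + κ v = h` in `(0,1)` with `v(0) = v(1)` and
`v'(0) = v'(1)`. -/
structure IsSolution (n : ℕ) (f κ : PerC2) (h v : ℝ → ℝ) : Prop where
  contDiffOn : ContDiffOn ℝ 2 v (Icc 0 1)
  equation : ∀ r ∈ Ioo (0 : ℝ) 1,
    -deriv (deriv v) r - n * (deriv f r / f r) * deriv v r + κ r * v r = h r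
  boundary : v 0 = v 1
  boundary_deriv : derivWithin v (Icc 0 1) 0 = derivWithin v (Icc 0 1) 1

/-- `G` is the Green's function of `-v'' - n (f'/f) v' + κ v` with periodic boundary conditions:
it is continuous on `[0,1]²` and, for every smooth `h`, the function `r ↦ ∫₀¹ G(r,s) h(s) ds` is
the unique solution of the periodic problem with right-hand side `h`. These properties determine
`G` on `[0,1]²`. -/
structure IsGreen (n : ℕ) (f κ : PerC2) (G : ℝ → ℝ → ℝ) : Prop where
  continuousOn : ContinuousOn (fun p : ℝ × ℝ => G p.1 p.2) (Icc 0 1 ×ˢ Icc 0 1)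
  solves : ∀ h : ℝ → ℝ, ContDiff ℝ ∞ h →
    IsSolution n f κ h (fun r => ∫ s in (0 : ℝ)..1, G r s * h s)
  unique : ∀ h : ℝ → ℝ, ContDiff ℝ ∞ h → ∀ v : ℝ → ℝ, IsSolution n f κ h v →
    EqOn v (fun r => ∫ s in (0 : ℝ)..1, G r s * h s) (Icc 0 1)

/-- The Green's function `G_{f,κ}` (an arbitrary function if there is none). -/
def green (n : ℕ) (f κ : PerC2) : ℝ → ℝ → ℝ := Classical.epsilon (IsGreen n f κ)

/-- The singular part `Γ`: zero for `r ≤ s`, and `-fⁿ(s) ∫ₛʳ f⁻ⁿ` for `s < r`. -/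
def singularPart (n : ℕ) (f : PerC2) (r s : ℝ) : ℝ :=
  if s < r then -(f s ^ n * ∫ t in s..r, 1 / f t ^ n) else 0

/-- The regular part `H_{f,κ} = G_{f,κ} - Γ`. -/
def regularPart (n : ℕ) (f κ : PerC2) (r s : ℝ) : ℝ := green n f κ r s - singularPart n f r s

/-- `𝒱_{f,κ}(r) = H_{f,κ}(r,r) / fⁿ(r)`. -/
def potential (n : ℕ) (f κ : PerC2) (r : ℝ) : ℝ := regularPart n f κ r r / f r ^ n

/-- `𝒱_{f,κ}` is well defined: `f > 0` on `[0,1]`, the operator is coercive, its Green's function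
exists, and `𝒱_{f,κ}` is of class `C²` on `[0,1]`. -/
structure IsAdmissible (n : ℕ) (f κ : PerC2) : Prop where
  positive : IsPositive f
  coercive : IsCoercive n f κ
  isGreen : IsGreen n f κ (green n f κ)
  contDiffOn : ContDiffOn ℝ 2 (potential n f κ) (Icc 0 1)

/-- Every critical point `r ∈ [0,1]` of `V : [0,1] → ℝ` is non-degenerate, that is
`V'(r) = 0` implies `V''(r) ≠ 0` (one-sided derivatives at the end points). -/
def AllCriticalPointsNondegenerate (V : ℝ → ℝ) : Prop :=
  ∀ r ∈ Icc (0 : ℝ) 1, derivWithin V (Icc 0 1) r = 0 →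
    derivWithin (derivWithin V (Icc 0 1)) (Icc 0 1) r ≠ 0

end WarpedGreen

end

noncomputable section

namespace WarpedGreen

open Filter Topology

/-! With `z = fⁿ v'` the homogeneous equation becomes the periodic system `v' = a z`, `z' = b v`,
where `a = f⁻ⁿ` and `b = fⁿ κ`. Let `M(r) = [[A, B], [C, D]]` be its monodromy matrix based at `r`;
it has determinant 1 and a trace independent of `r`. Coercivity forces the trace above 2
(`IsCoercive.two_lt_trc`), so the periodic problem is uniquely solvable. The explicit Green's
function then gives `𝒱 = B / (trace - 2)` on `[0,1]` (`IsPositive.potential_eq`). Since `B' = a (D -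
A)`, critical points of `𝒱` are zeros of the gap `D - A`, and they are non-degenerate exactly when
these zeros are simple.

Simple zeros are generic by a Sard argument (`exists_forall_simple_zero`,
`mem_closure_simple_zeros`): it suffices that at each zero of the gap some direction in parameter
space moves the gap at a non-zero rate. Duhamel's formula (`gap_sub_gap`) expresses that rate as an
integral against `gapVarB` and `gapVarA`, the off-diagonal entries of `W(s) = T(s,r) diag(-1,1)
T(r+1,s)`, with `T` the transfer matrix.

At a zero of the gap `A = D = trace/2 > 1`, so `BC = A² - 1 > 0`. When `κ` varies, the weight is `fⁿ
gapVarB`, whose value at `s = r` is `-fⁿ B ≠ 0`. When `f` varies, it is `(n/f)(b gapVarB - a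
gapVarA)`. If this vanished identically, `gapVarB gapVarA` would be constant, equal to `-BC ≠ 0`;
but `gapVarB` runs from `-B` to `B` over one period and must vanish somewhere (`exists_gapVar_ne`).
-/

theorem summable_mul_pow_div_factorial (c M : ℝ) :
    Summable fun k : ℕ => c * (M ^ k / k.factorial) :=
  (Real.summable_pow_div_factorial M).mul_left _

/-! ### Linear differential equations: Peano–Baker series and continuous dependence on parameters.
-/

section LinearODE

variable {E : Type*} [NormedAddCommGroup E] [NormedSpace ℝ E]

/-- The terms of the Peano–Baker series of `x' = A x`, `x(0) = x₀`. -/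
def peanoBaker (A : ℝ → E →L[ℝ] E) (x₀ : E) : ℕ → ℝ → E
  | 0 => fun _ => x₀
  | k + 1 => fun r => ∫ s in (0 : ℝ)..r, A s (peanoBaker A x₀ k s)

/-- The sum of the Peano–Baker series: the solution of `x' = A x`, `x(0) = x₀`. -/
def linearFlow (A : ℝ → E →L[ℝ] E) (x₀ : E) (r : ℝ) : E := ∑' k, peanoBaker A x₀ k r

theorem continuous_peanoBaker_uncurry {Θ : Type*} [TopologicalSpace Θ] {A : Θ → ℝ → E →L[ℝ] E}
    (hA : Continuous fun q : Θ × ℝ => A q.1 q.2) (x₀ : E) (k : ℕ) :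
    Continuous fun q : Θ × ℝ => peanoBaker (A q.1) x₀ k q.2 := by
  induction k with
  | zero => exact continuous_const
  | succ k ih =>
    have h : Continuous fun q : (Θ × ℝ) × ℝ => A q.1.1 q.2 (peanoBaker (A q.1.1) x₀ k q.2) :=
      (hA.comp (by fun_prop : Continuous fun q : (Θ × ℝ) × ℝ => (q.1.1, q.2))).clm_apply
        (ih.comp (by fun_prop : Continuous fun q : (Θ × ℝ) × ℝ => (q.1.1, q.2)))
    exact intervalIntegral.continuous_parametric_intervalIntegral_of_continuous
      (f := fun q : Θ × ℝ => fun s => A q.1 s (peanoBaker (A q.1) x₀ k s)) h continuous_snd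

/-- Each integration turns `|s|^k / k!` into `|r|^(k+1) / (k+1)!`. The resulting exponential
majorant drives every convergence argument for the series. -/
theorem norm_peanoBaker_le {A : ℝ → E →L[ℝ] E} (x₀ : E) {K R : ℝ}
    (hK : ∀ s, |s| ≤ R → ‖A s‖ ≤ K) (k : ℕ) {r : ℝ} (hr : |r| ≤ R) :
    ‖peanoBaker A x₀ k r‖ ≤ ‖x₀‖ * ((K * |r|) ^ k / k.factorial) := by
  have hK0 : 0 ≤ K := (norm_nonneg _).trans (hK r hr)
  induction k generalizing r with
  | zero => simp [peanoBaker]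
  | succ k ih =>
    have hmem : ∀ s ∈ uIoc 0 r, |s| ≤ R := fun s hs => by
      refine le_trans ?_ hr
      rcases le_total 0 r with h | h
      · rw [uIoc_of_le h] at hs
        rw [abs_of_pos hs.1, abs_of_nonneg h]
        exact hs.2
      · rw [uIoc_of_ge h] at hs
        rw [abs_of_nonpos hs.2, abs_of_nonpos h]
        linarith [hs.1]
    have hpt : ∀ s ∈ uIoc 0 r, ‖A s (peanoBaker A x₀ k s)‖ ≤
        K ^ (k + 1) * ‖x₀‖ / k.factorial * |s - 0| ^ k := fun s hs => by
      calc ‖A s (peanoBaker A x₀ k s)‖ ≤ ‖A s‖ * ‖peanoBaker A x₀ k s‖ := (A s).le_opNorm _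
        _ ≤ K * (‖x₀‖ * ((K * |s|) ^ k / k.factorial)) := by
          gcongr
          · exact hK s (hmem s hs)
          · exact ih (hmem s hs)
        _ = _ := by rw [mul_pow, sub_zero]; ring
    have hint : IntegrableOn (fun s : ℝ => K ^ (k + 1) * ‖x₀‖ / k.factorial * |s - 0| ^ k)
        (uIoc 0 r) :=
      (Continuous.integrableOn_uIcc (by fun_prop)).mono_set uIoc_subset_uIcc
    calc ‖∫ s in (0 : ℝ)..r, A s (peanoBaker A x₀ k s)‖
        ≤ ∫ s in uIoc 0 r, ‖A s (peanoBaker A x₀ k s)‖ :=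
          intervalIntegral.norm_integral_le_integral_norm_uIoc
      _ ≤ ∫ s in uIoc 0 r, K ^ (k + 1) * ‖x₀‖ / k.factorial * |s - 0| ^ k := by
          refine integral_mono_of_nonneg (.of_forall fun s => norm_nonneg _) hint ?_
          exact (ae_restrict_mem measurableSet_uIoc).mono hpt
      _ = _ := by
          rw [integral_const_mul, integral_pow_abs_sub_uIoc, sub_zero, Nat.factorial_succ,
            mul_pow, Nat.cast_mul]
          push_cast
          field_simp

theorem linearFlow_zero (A : ℝ → E →L[ℝ] E) (x₀ : E) : linearFlow A x₀ 0 = x₀ := by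
  rw [linearFlow, tsum_eq_single 0]
  · rfl
  · intro k hk
    obtain ⟨m, rfl⟩ := Nat.exists_eq_succ_of_ne_zero hk
    simp [peanoBaker]

/-- Compactness of `[-R, R]` makes the bound uniform near `θ₀`, so that one majorant serves all
nearby parameters. -/
theorem exists_norm_le_of_continuous {Θ F : Type*} [TopologicalSpace Θ] [SeminormedAddCommGroup F]
    {A : Θ → ℝ → F} (hA : Continuous fun q : Θ × ℝ => A q.1 q.2) (θ₀ : Θ) (R : ℝ) :
    ∃ K : ℝ, ∀ᶠ θ in 𝓝 θ₀, ∀ s, |s| ≤ R → ‖A θ s‖ ≤ K := by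
  obtain ⟨K, hK⟩ := (isCompact_Icc (a := -R) (b := R)).exists_bound_of_continuousOn
    (f := fun s => A θ₀ s) (by fun_prop)
  refine ⟨K + 1, ?_⟩
  have := (isCompact_Icc (a := -R) (b := R)).eventually_forall_of_forall_eventually
    (x₀ := θ₀) (P := fun θ s => ‖A θ s‖ ≤ K + 1) fun s hs => by
      have : ∀ᶠ z : Θ × ℝ in 𝓝 (θ₀, s), ‖A z.1 z.2‖ < K + 1 :=
        hA.norm.continuousAt.eventually_lt continuousAt_const (by linarith [hK s hs])
      exact this.mono fun _ h => h.le
  exact this.mono fun θ h s hs => h s (abs_le.1 hs)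

variable [CompleteSpace E]

/-- Weierstrass M-test near each point. The parameter space is arbitrary because the parameters will
be the functions `f` and `κ` themselves. -/
theorem continuous_linearFlow_uncurry {Θ : Type*} [TopologicalSpace Θ] {A : Θ → ℝ → E →L[ℝ] E}
    (hA : Continuous fun q : Θ × ℝ => A q.1 q.2) (x₀ : E) :
    Continuous fun q : Θ × ℝ => linearFlow (A q.1) x₀ q.2 := by
  refine continuous_iff_continuousAt.2 fun ⟨θ₀, r₀⟩ => ?_
  obtain ⟨K, hK⟩ := exists_norm_le_of_continuous hA θ₀ (|r₀| + 1)
  have hr : ∀ᶠ r in 𝓝 r₀, |r| ≤ |r₀| + 1 :=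
    (continuous_abs.continuousAt.eventually_lt continuousAt_const (by linarith)).mono
      fun _ h => le_of_lt h
  have hmem := hK.prod_nhds hr
  refine ContinuousOn.continuousAt (continuousOn_tsum
    (fun k => (continuous_peanoBaker_uncurry hA x₀ k).continuousOn)
    (summable_mul_pow_div_factorial ‖x₀‖ (K * (|r₀| + 1))) ?_) hmem
  rintro k ⟨θ, r⟩ ⟨h1, h2⟩
  have hK0 : 0 ≤ K := (norm_nonneg _).trans (h1 r h2)
  refine (norm_peanoBaker_le x₀ h1 k h2).trans ?_
  gcongr

theorem hasDerivAt_linearFlow {A : ℝ → E →L[ℝ] E} (hA : Continuous A) (x₀ : E) (r : ℝ) :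
    HasDerivAt (linearFlow A x₀) (A r (linearFlow A x₀ r)) r := by
  have hA' : Continuous fun q : Unit × ℝ => A q.2 := hA.comp continuous_snd
  obtain ⟨K, hK⟩ := exists_norm_le_of_continuous (A := fun _ : Unit => A) hA' () (|r| + 1)
  have hK := hK.self_of_nhds
  have hc : ∀ k, Continuous (peanoBaker A x₀ k) := fun k =>
    (continuous_peanoBaker_uncurry (A := fun _ : Unit => A) hA' x₀ k).comp
      (by fun_prop : Continuous fun s : ℝ => ((), s))
  have hK0 : 0 ≤ K := (norm_nonneg _).trans (hK r (by linarith))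
  have hbound : ∀ k s, |s| ≤ |r| + 1 →
      ‖peanoBaker A x₀ k s‖ ≤ ‖x₀‖ * ((K * (|r| + 1)) ^ k / k.factorial) := fun k s hs => by
    refine (norm_peanoBaker_le x₀ hK k hs).trans ?_
    gcongr
  have hsum : ∀ s, |s| ≤ |r| + 1 → Summable fun k => peanoBaker A x₀ k s := fun s hs =>
    .of_norm_bounded (summable_mul_pow_div_factorial ‖x₀‖ _) fun k => hbound k s hs
  have hball : ∀ s, s ∈ Metric.ball (0 : ℝ) (|r| + 1) → |s| ≤ |r| + 1 := fun s hs => by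
    rw [mem_ball_zero_iff, Real.norm_eq_abs] at hs
    exact hs.le
  have hr : r ∈ Metric.ball (0 : ℝ) (|r| + 1) := by simp
  -- Only the tail of the series is differentiated: term `k + 1` has derivative `A` applied to term
  -- `k`, and the constant term of index 0 is added back afterwards.
  have hder := hasDerivAt_tsum_of_isPreconnected (t := Metric.ball (0 : ℝ) (|r| + 1))
    (g := fun k => peanoBaker A x₀ (k + 1)) (g' := fun k s => A s (peanoBaker A x₀ k s))
    (u := fun k => K * (‖x₀‖ * ((K * (|r| + 1)) ^ k / k.factorial)))
    ((summable_mul_pow_div_factorial ‖x₀‖ _).mul_left K) Metric.isOpen_ball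
    (convex_ball _ _).isPreconnected
    (fun k s _ => intervalIntegral.integral_hasDerivAt_right
      ((hA.clm_apply (hc k)).intervalIntegrable _ _)
      (hA.clm_apply (hc k)).aestronglyMeasurable.stronglyMeasurableAtFilter
      (hA.clm_apply (hc k)).continuousAt)
    (fun k s hs => ((A s).le_opNorm _).trans
      (mul_le_mul (hK s (hball s hs)) (hbound k s (hball s hs)) (norm_nonneg _) hK0))
    hr ((summable_nat_add_iff 1).2 (hsum r (hball r hr))) hr
  have heq : linearFlow A x₀ =ᶠ[𝓝 r] fun s => x₀ + ∑' k, peanoBaker A x₀ (k + 1) s := by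
    filter_upwards [Metric.isOpen_ball.mem_nhds hr] with s hs
    rw [linearFlow, (hsum s (hball s hs)).tsum_eq_zero_add]
    rfl
  have hA2 : A r (linearFlow A x₀ r) = ∑' k, A r (peanoBaker A x₀ k r) :=
    (A r).map_tsum (hsum r (hball r hr))
  rw [hA2]
  exact (hder.const_add x₀).congr_of_eventuallyEq heq

end LinearODE

/-! ### The planar periodic system and its monodromy matrix. -/

/-- The matrix `[[0, a], [b, 0]]` as an operator on `ℝ × ℝ`. -/
def offDiag (a b : ℝ) : ℝ × ℝ →L[ℝ] ℝ × ℝ :=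
  a • (ContinuousLinearMap.inl ℝ ℝ ℝ).comp (ContinuousLinearMap.snd ℝ ℝ ℝ) +
    b • (ContinuousLinearMap.inr ℝ ℝ ℝ).comp (ContinuousLinearMap.fst ℝ ℝ ℝ)

theorem offDiag_apply (a b : ℝ) (x : ℝ × ℝ) : offDiag a b x = (a * x.2, b * x.1) := by
  simp [offDiag]

/-- The solution of the system `v' = a z`, `z' = b v` with initial value `x₀`. -/
def sysSol (a b : ℝ → ℝ) (x₀ : ℝ × ℝ) : ℝ → ℝ × ℝ := linearFlow (fun s => offDiag (a s) (b s)) x₀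

theorem continuous_sysSol_uncurry {Θ : Type*} [TopologicalSpace Θ] {a b : Θ → ℝ → ℝ}
    (ha : Continuous fun q : Θ × ℝ => a q.1 q.2) (hb : Continuous fun q : Θ × ℝ => b q.1 q.2)
    (x₀ : ℝ × ℝ) : Continuous fun q : Θ × ℝ => sysSol (a q.1) (b q.1) x₀ q.2 :=
  continuous_linearFlow_uncurry (A := fun θ s => offDiag (a θ s) (b θ s))
    ((ha.smul continuous_const).add (hb.smul continuous_const)) x₀

/-- An entry of the fundamental matrix `[[φ₁, φ₂], [ψ₁, ψ₂]]`. -/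
def phi₁ (a b : ℝ → ℝ) (r : ℝ) : ℝ := (sysSol a b (1, 0) r).1
/-- An entry of the fundamental matrix `[[φ₁, φ₂], [ψ₁, ψ₂]]`. -/
def psi₁ (a b : ℝ → ℝ) (r : ℝ) : ℝ := (sysSol a b (1, 0) r).2
/-- An entry of the fundamental matrix `[[φ₁, φ₂], [ψ₁, ψ₂]]`. -/
def phi₂ (a b : ℝ → ℝ) (r : ℝ) : ℝ := (sysSol a b (0, 1) r).1
/-- An entry of the fundamental matrix `[[φ₁, φ₂], [ψ₁, ψ₂]]`. -/
def psi₂ (a b : ℝ → ℝ) (r : ℝ) : ℝ := (sysSol a b (0, 1) r).2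

section Parametric

variable {Θ : Type*} [TopologicalSpace Θ] {a b : Θ → ℝ → ℝ}
  (ha : Continuous fun q : Θ × ℝ => a q.1 q.2) (hb : Continuous fun q : Θ × ℝ => b q.1 q.2)
include ha hb

theorem continuous_phi₁_uncurry : Continuous fun q : Θ × ℝ => phi₁ (a q.1) (b q.1) q.2 :=
  (continuous_sysSol_uncurry ha hb _).fst
theorem continuous_psi₁_uncurry : Continuous fun q : Θ × ℝ => psi₁ (a q.1) (b q.1) q.2 :=
  (continuous_sysSol_uncurry ha hb _).snd
theorem continuous_phi₂_uncurry : Continuous fun q : Θ × ℝ => phi₂ (a q.1) (b q.1) q.2 :=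
  (continuous_sysSol_uncurry ha hb _).fst
theorem continuous_psi₂_uncurry : Continuous fun q : Θ × ℝ => psi₂ (a q.1) (b q.1) q.2 :=
  (continuous_sysSol_uncurry ha hb _).snd

end Parametric

/-- The coefficients of a system `v' = a z`, `z' = b v` are continuous and 1-periodic. -/
structure IsPeriodicSystem (a b : ℝ → ℝ) : Prop where
  continuous_left : Continuous a
  continuous_right : Continuous b
  periodic_left : Function.Periodic a 1
  periodic_right : Function.Periodic b 1

section Initial

variable (a b : ℝ → ℝ)

@[simp] theorem phi₁_zero : phi₁ a b 0 = 1 := by simp [phi₁, sysSol, linearFlow_zero]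
@[simp] theorem psi₁_zero : psi₁ a b 0 = 0 := by simp [psi₁, sysSol, linearFlow_zero]
@[simp] theorem phi₂_zero : phi₂ a b 0 = 0 := by simp [phi₂, sysSol, linearFlow_zero]
@[simp] theorem psi₂_zero : psi₂ a b 0 = 1 := by simp [psi₂, sysSol, linearFlow_zero]

/-- The entries `[[α, β], [γ, δ]]` of the monodromy matrix `Φ(r+1) Φ(r)⁻¹` with base point `r`,
where `Φ` is the fundamental matrix. -/
def monA (r : ℝ) : ℝ := phi₁ a b (r + 1) * psi₂ a b r - phi₂ a b (r + 1) * psi₁ a b r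
/-- An entry of the monodromy matrix `[[α, β], [γ, δ]]` with base point `r`. -/
def monB (r : ℝ) : ℝ := phi₂ a b (r + 1) * phi₁ a b r - phi₁ a b (r + 1) * phi₂ a b r
/-- An entry of the monodromy matrix `[[α, β], [γ, δ]]` with base point `r`. -/
def monC (r : ℝ) : ℝ := psi₁ a b (r + 1) * psi₂ a b r - psi₂ a b (r + 1) * psi₁ a b r
/-- An entry of the monodromy matrix `[[α, β], [γ, δ]]` with base point `r`. -/
def monD (r : ℝ) : ℝ := psi₂ a b (r + 1) * phi₁ a b r - psi₁ a b (r + 1) * phi₂ a b r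

/-- The trace of the monodromy matrix. -/
def trc : ℝ := phi₁ a b 1 + psi₂ a b 1

/-- The difference of the diagonal entries of the monodromy matrix. -/
def gap (r : ℝ) : ℝ := monD a b r - monA a b r

end Initial

namespace IsPeriodicSystem

variable {a b : ℝ → ℝ} (h : IsPeriodicSystem a b)
include h

theorem hasDerivAt_sysSol (x₀ : ℝ × ℝ) (r : ℝ) : HasDerivAt (sysSol a b x₀)
    (a r * (sysSol a b x₀ r).2, b r * (sysSol a b x₀ r).1) r := by
  have := hasDerivAt_linearFlow (A := fun s => offDiag (a s) (b s))
    ((h.continuous_left.smul continuous_const).add (h.continuous_right.smul continuous_const)) x₀ r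
  rwa [offDiag_apply] at this

theorem hasDerivAt_phi₁ (r : ℝ) : HasDerivAt (phi₁ a b) (a r * psi₁ a b r) r :=
  (h.hasDerivAt_sysSol _ r).fst
theorem hasDerivAt_psi₁ (r : ℝ) : HasDerivAt (psi₁ a b) (b r * phi₁ a b r) r :=
  (h.hasDerivAt_sysSol _ r).snd
theorem hasDerivAt_phi₂ (r : ℝ) : HasDerivAt (phi₂ a b) (a r * psi₂ a b r) r :=
  (h.hasDerivAt_sysSol _ r).fst
theorem hasDerivAt_psi₂ (r : ℝ) : HasDerivAt (psi₂ a b) (b r * phi₂ a b r) r :=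
  (h.hasDerivAt_sysSol _ r).snd

theorem continuous_phi₁ : Continuous (phi₁ a b) :=
  continuous_iff_continuousAt.2 fun r => (h.hasDerivAt_phi₁ r).continuousAt
theorem continuous_psi₁ : Continuous (psi₁ a b) :=
  continuous_iff_continuousAt.2 fun r => (h.hasDerivAt_psi₁ r).continuousAt
theorem continuous_phi₂ : Continuous (phi₂ a b) :=
  continuous_iff_continuousAt.2 fun r => (h.hasDerivAt_phi₂ r).continuousAt
theorem continuous_psi₂ : Continuous (psi₂ a b) :=
  continuous_iff_continuousAt.2 fun r => (h.hasDerivAt_psi₂ r).continuousAt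

/-- Liouville's formula: the coefficient matrix has trace zero. -/
theorem wronskian (r : ℝ) : phi₁ a b r * psi₂ a b r - phi₂ a b r * psi₁ a b r = 1 := by
  have hd : ∀ r, HasDerivAt (fun r => phi₁ a b r * psi₂ a b r - phi₂ a b r * psi₁ a b r) 0 r :=
    fun r => (((h.hasDerivAt_phi₁ r).mul (h.hasDerivAt_psi₂ r)).sub
      ((h.hasDerivAt_phi₂ r).mul (h.hasDerivAt_psi₁ r))).congr_deriv (by ring)
  have := is_const_of_deriv_eq_zero (fun r => (hd r).differentiableAt) (fun r => (hd r).deriv) r 0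
  simpa using this

/-- A solution on `[0,1]` is the combination of the fundamental solutions given by its
initial value. -/
theorem eq_of_hasDerivWithinAt {v z : ℝ → ℝ}
    (hv : ∀ r ∈ Icc (0 : ℝ) 1, HasDerivWithinAt v (a r * z r) (Icc 0 1) r)
    (hz : ∀ r ∈ Icc (0 : ℝ) 1, HasDerivWithinAt z (b r * v r) (Icc 0 1) r)
    {r : ℝ} (hr : r ∈ Icc (0 : ℝ) 1) :
    v r = v 0 * phi₁ a b r + z 0 * phi₂ a b r ∧ z r = v 0 * psi₁ a b r + z 0 * psi₂ a b r := by
  have key : ∀ f : ℝ → ℝ, (∀ r ∈ Icc (0 : ℝ) 1, HasDerivWithinAt f 0 (Icc 0 1) r) → f r = f 0 :=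
    fun f hf => constant_of_derivWithin_zero (fun s hs => (hf s hs).differentiableWithinAt)
      (fun s hs => (hf s (Ico_subset_Icc_self hs)).derivWithin
        (uniqueDiffOn_Icc one_pos s (Ico_subset_Icc_self hs))) r hr
  -- The two conserved quantities are the components of `Φ⁻¹ (v, z)`, where `Φ⁻¹ = [[ψ₂, -φ₂], [-ψ₁,
  -- φ₁]]` by the Wronskian identity.
  have h1 := key (fun r => psi₂ a b r * v r - phi₂ a b r * z r) fun r hr =>
    (((h.hasDerivAt_psi₂ r).hasDerivWithinAt.mul (hv r hr)).sub
      ((h.hasDerivAt_phi₂ r).hasDerivWithinAt.mul (hz r hr))).congr_deriv (by ring)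
  have h2 := key (fun r => phi₁ a b r * z r - psi₁ a b r * v r) fun r hr =>
    (((h.hasDerivAt_phi₁ r).hasDerivWithinAt.mul (hz r hr)).sub
      ((h.hasDerivAt_psi₁ r).hasDerivWithinAt.mul (hv r hr))).congr_deriv (by ring)
  simp only [phi₁_zero, phi₂_zero, psi₁_zero, psi₂_zero] at h1 h2
  have w := h.wronskian r
  constructor
  · linear_combination phi₁ a b r * h1 + phi₂ a b r * h2 - v r * w
  · linear_combination psi₁ a b r * h1 + psi₂ a b r * h2 - z r * w

theorem hasDerivAt_shift (r : ℝ) :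
    HasDerivAt (fun r => phi₁ a b (r + 1)) (a r * psi₁ a b (r + 1)) r ∧
    HasDerivAt (fun r => psi₁ a b (r + 1)) (b r * phi₁ a b (r + 1)) r ∧
    HasDerivAt (fun r => phi₂ a b (r + 1)) (a r * psi₂ a b (r + 1)) r ∧
    HasDerivAt (fun r => psi₂ a b (r + 1)) (b r * phi₂ a b (r + 1)) r := by
  have ea := h.periodic_left r
  have eb := h.periodic_right r
  refine ⟨?_, ?_, ?_, ?_⟩
  · exact ((h.hasDerivAt_phi₁ (r + 1)).comp_add_const r 1).congr_deriv (by rw [ea])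
  · exact ((h.hasDerivAt_psi₁ (r + 1)).comp_add_const r 1).congr_deriv (by rw [eb])
  · exact ((h.hasDerivAt_phi₂ (r + 1)).comp_add_const r 1).congr_deriv (by rw [ea])
  · exact ((h.hasDerivAt_psi₂ (r + 1)).comp_add_const r 1).congr_deriv (by rw [eb])

/-- By periodicity the translated columns solve the same system, hence `Φ(r+1) = Φ(r) Φ(1)`; this is
its first row. -/
theorem floquet {r : ℝ} (hr : r ∈ Icc (0 : ℝ) 1) :
    (phi₁ a b (r + 1) = phi₁ a b 1 * phi₁ a b r + psi₁ a b 1 * phi₂ a b r) ∧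
    (phi₂ a b (r + 1) = phi₂ a b 1 * phi₁ a b r + psi₂ a b 1 * phi₂ a b r) := by
  have h1 := h.eq_of_hasDerivWithinAt (fun s _ => (h.hasDerivAt_shift s).1.hasDerivWithinAt)
    (fun s _ => (h.hasDerivAt_shift s).2.1.hasDerivWithinAt) hr
  have h2 := h.eq_of_hasDerivWithinAt (fun s _ => (h.hasDerivAt_shift s).2.2.1.hasDerivWithinAt)
    (fun s _ => (h.hasDerivAt_shift s).2.2.2.hasDerivWithinAt) hr
  simp only [zero_add] at h1 h2
  exact ⟨h1.1, h2.1⟩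

/-- This and the next three lemmas are the entries of `M' = N M - M N` with `N = [[0, a], [b, 0]]`.
-/
theorem hasDerivAt_monA (r : ℝ) :
    HasDerivAt (monA a b) (a r * monC a b r - b r * monB a b r) r := by
  obtain ⟨h1, -, h2, -⟩ := h.hasDerivAt_shift r
  exact ((h1.mul (h.hasDerivAt_psi₂ r)).sub (h2.mul (h.hasDerivAt_psi₁ r))).congr_deriv
    (by simp only [monB, monC]; ring)

theorem hasDerivAt_monB (r : ℝ) : HasDerivAt (monB a b) (a r * gap a b r) r := by
  obtain ⟨h1, -, h2, -⟩ := h.hasDerivAt_shift r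
  exact ((h2.mul (h.hasDerivAt_phi₁ r)).sub (h1.mul (h.hasDerivAt_phi₂ r))).congr_deriv
    (by simp only [gap, monA, monD]; ring)

theorem hasDerivAt_monC (r : ℝ) : HasDerivAt (monC a b) (-(b r * gap a b r)) r := by
  obtain ⟨-, h1, -, h2⟩ := h.hasDerivAt_shift r
  exact ((h1.mul (h.hasDerivAt_psi₂ r)).sub (h2.mul (h.hasDerivAt_psi₁ r))).congr_deriv
    (by simp only [gap, monA, monD]; ring)

theorem hasDerivAt_monD (r : ℝ) :
    HasDerivAt (monD a b) (b r * monB a b r - a r * monC a b r) r := by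
  obtain ⟨-, h1, -, h2⟩ := h.hasDerivAt_shift r
  exact ((h2.mul (h.hasDerivAt_phi₁ r)).sub (h1.mul (h.hasDerivAt_phi₂ r))).congr_deriv
    (by simp only [monB, monC]; ring)

theorem hasDerivAt_gap (r : ℝ) :
    HasDerivAt (gap a b) (2 * (b r * monB a b r - a r * monC a b r)) r :=
  ((h.hasDerivAt_monD r).sub (h.hasDerivAt_monA r)).congr_deriv (by ring)

theorem monA_add_monD (r : ℝ) : monA a b r + monD a b r = trc a b := by
  have hd : ∀ r, HasDerivAt (fun r => monA a b r + monD a b r) 0 r := fun r =>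
    ((h.hasDerivAt_monA r).add (h.hasDerivAt_monD r)).congr_deriv (by ring)
  have := is_const_of_deriv_eq_zero (fun r => (hd r).differentiableAt) (fun r => (hd r).deriv) r 0
  rw [this]
  simp [monA, monD, trc]

theorem mon_det (r : ℝ) : monA a b r * monD a b r - monB a b r * monC a b r = 1 := by
  have w1 := h.wronskian r
  have w2 := h.wronskian (r + 1)
  simp only [monA, monB, monC, monD]
  linear_combination w2 + (phi₁ a b (r + 1) * psi₂ a b (r + 1) -
    phi₂ a b (r + 1) * psi₁ a b (r + 1)) * w1

end IsPeriodicSystem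

/-! ### Coercivity and the trace of the monodromy matrix. -/

/-- The coefficient `f⁻ⁿ` of the system `v' = f⁻ⁿ z`, `z' = fⁿ κ v` equivalent to
`-v'' - n (f'/f) v' + κ v = 0`. -/
def coefA (n : ℕ) (f : PerC2) (s : ℝ) : ℝ := 1 / f s ^ n

/-- The coefficient `fⁿ κ` of the system `v' = f⁻ⁿ z`, `z' = fⁿ κ v`. -/
def coefB (n : ℕ) (f κ : PerC2) (s : ℝ) : ℝ := f s ^ n * κ s

theorem PerC2.continuous (f : PerC2) : Continuous f := f.contDiff.continuous

section

variable {n : ℕ} {f κ : PerC2}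

theorem IsPositive.pos (hf : IsPositive f) (s : ℝ) : 0 < f s := by
  obtain ⟨y, hy, hxy⟩ := f.periodic.exists_mem_Ico₀ one_pos s
  rw [hxy]
  exact hf y (Ico_subset_Icc_self hy)

theorem IsPositive.pow_pos (hf : IsPositive f) (n : ℕ) (s : ℝ) : 0 < f s ^ n :=
  _root_.pow_pos (hf.pos s) n

theorem IsPositive.coefA_pos (hf : IsPositive f) (n : ℕ) (s : ℝ) : 0 < coefA n f s :=
  one_div_pos.2 (hf.pow_pos n s)

theorem IsPositive.isPeriodicSystem (hf : IsPositive f) (n : ℕ) (κ : PerC2) :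
    IsPeriodicSystem (coefA n f) (coefB n f κ) where
  continuous_left := continuous_const.div (f.continuous.pow n) fun s => (hf.pow_pos n s).ne'
  continuous_right := (f.continuous.pow n).mul κ.continuous
  periodic_left s := by simp only [coefA, f.periodic s]
  periodic_right s := by simp only [coefB, f.periodic s, κ.periodic s]

/-- Coercivity, tested with a solution on `[0,t]` that is extended by zero if `t < 1`. -/
theorem IsCoercive.boundary_form_pos (hc : IsCoercive n f κ) (hf : IsPositive f) {v z : ℝ → ℝ}
    (hv : ∀ r, HasDerivAt v (coefA n f r * z r) r) (hz : ∀ r, HasDerivAt z (coefB n f κ r * v r) r)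
    {t : ℝ} (ht : t ∈ Ioc (0 : ℝ) 1) (ht' : t = 1 ∨ v t = 0) (hvt : v 0 = v t)
    (hne : v 0 ≠ 0 ∨ z 0 ≠ 0) : 0 < z t * v t - z 0 * v 0 := by
  obtain ⟨c, hc0, H⟩ := hc
  have hsys := hf.isPeriodicSystem n κ
  have cv : Continuous v := continuous_iff_continuousAt.2 fun r => (hv r).continuousAt
  have cz : Continuous z := continuous_iff_continuousAt.2 fun r => (hz r).continuousAt
  set w : ℝ → ℝ := fun r => coefA n f r * z r with hw
  have cw : Continuous w := hsys.continuous_left.mul cz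
  have htI : t ∈ Icc (0 : ℝ) 1 := Ioc_subset_Icc_self ht
  have hmem : MemLp (indicator {x | x ≤ t} w) 2 (volume.restrict (Icc (0 : ℝ) 1)) := by
    obtain ⟨C, hC⟩ := isCompact_Icc.exists_bound_of_continuousOn
      (cw.continuousOn (s := Icc (0 : ℝ) 1))
    exact (MemLp.of_bound cw.aestronglyMeasurable C
      ((ae_restrict_mem measurableSet_Icc).mono hC)).indicator measurableSet_Iic
  have hint : ∀ x ∈ Icc (0 : ℝ) 1, indicator {x | x ≤ t} v x =
      indicator {x | x ≤ t} v 0 + ∫ s in (0 : ℝ)..x, indicator {x | x ≤ t} w s := by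
    intro x hx
    have h0 : indicator {x | x ≤ t} v 0 = v 0 := indicator_of_mem (by exact htI.1) v
    have hFTC : ∀ y, ∫ s in (0 : ℝ)..y, w s = v y - v 0 := fun y =>
      intervalIntegral.integral_eq_sub_of_hasDerivAt (fun r _ => hv r) (cw.intervalIntegrable _ _)
    rw [h0]
    rcases le_or_gt x t with hxt | hxt
    · rw [indicator_of_mem (by exact hxt), intervalIntegral.integral_congr (g := w), hFTC]
      · ring
      · intro s hs
        rw [uIcc_of_le hx.1] at hs
        exact indicator_of_mem (show s ∈ {x | x ≤ t} from hs.2.trans hxt) w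
    · rw [indicator_of_notMem (by simpa using hxt),
        intervalIntegral.integral_indicator ⟨htI.1, hxt.le⟩, hFTC]
      rcases ht' with rfl | h
      · exact absurd hx.2 hxt.not_ge
      · rw [h]; ring
  have hbd : indicator {x | x ≤ t} v 0 = indicator {x | x ≤ t} v 1 := by
    rw [indicator_of_mem (by exact htI.1), hvt]
    rcases ht' with rfl | h
    · rw [indicator_of_mem (by exact le_refl (1 : ℝ))]
    · rcases htI.2.lt_or_eq with h1 | h1
      · rw [h, indicator_of_notMem (by simpa using h1)]
      · rw [h1, indicator_of_mem (by exact le_refl (1 : ℝ))]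
  have key := H _ _ hmem hint hbd
  have e1 : ∫ x in (0 : ℝ)..1,
      (indicator {x | x ≤ t} w x ^ 2 + indicator {x | x ≤ t} v x ^ 2) =
      ∫ x in (0 : ℝ)..t, (w x ^ 2 + v x ^ 2) := by
    rw [← intervalIntegral.integral_indicator htI]
    refine intervalIntegral.integral_congr fun x _ => ?_
    by_cases hx : x ≤ t <;> simp [indicator, hx]
  have e2 : ∫ x in (0 : ℝ)..1, f x ^ n *
      (indicator {x | x ≤ t} w x ^ 2 + κ x * indicator {x | x ≤ t} v x ^ 2) =
      ∫ x in (0 : ℝ)..t, f x ^ n * (w x ^ 2 + κ x * v x ^ 2) := by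
    rw [← intervalIntegral.integral_indicator htI]
    refine intervalIntegral.integral_congr fun x _ => ?_
    by_cases hx : x ≤ t <;> simp [indicator, hx]
  -- Energy identity: `(z v)' = b v² + a z² = fⁿ (w² + κ v²)` because `w = a z`.
  have e3 : ∫ x in (0 : ℝ)..t, f x ^ n * (w x ^ 2 + κ x * v x ^ 2) = z t * v t - z 0 * v 0 := by
    refine intervalIntegral.integral_eq_sub_of_hasDerivAt (f := fun r => z r * v r)
      (fun r _ => ((hz r).mul (hv r)).congr_deriv ?_) (Continuous.intervalIntegrable ?_ _ _)
    · have := (hf.pow_pos n r).ne'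
      simp only [hw, coefA, coefB]
      field_simp
      ring
    · exact (f.continuous.pow n).mul ((cw.pow 2).add (κ.continuous.mul (cv.pow 2)))
  rw [e1, e2, e3] at key
  refine lt_of_lt_of_le (mul_pos hc0 ?_) key
  have hpos := intervalIntegral.integral_lt_integral_of_continuousOn_of_le_of_exists_lt
    (f := fun _ => (0 : ℝ)) (g := fun x => w x ^ 2 + v x ^ 2) ht.1 continuousOn_const
    ((cw.pow 2).add (cv.pow 2)).continuousOn (fun x _ => by positivity)
    ⟨0, ⟨le_rfl, htI.1⟩, ?_⟩
  · simpa using hpos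
  · rcases hne with h | h
    · have : 0 < v 0 ^ 2 := by positivity
      positivity
    · have h' : w 0 ≠ 0 := mul_ne_zero (hf.coefA_pos n 0).ne' h
      have : 0 < w 0 ^ 2 := by positivity
      positivity

/-- The solution `φ₂` leaves 0 with positive slope. If it were not positive at 1, it would return to
0 at some `t ∈ (0,1]`; extended by zero beyond `t`, it would be a test function with vanishing
energy. -/
theorem IsCoercive.phi₂_one_pos (hc : IsCoercive n f κ) (hf : IsPositive f) :
    0 < phi₂ (coefA n f) (coefB n f κ) 1 := by
  have hsys := hf.isPeriodicSystem n κ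
  by_contra! hneg
  have hd := hsys.hasDerivAt_phi₂ 0
  rw [psi₂_zero, mul_one] at hd
  obtain ⟨s, hs, hs1, hs0⟩ : ∃ s : ℝ, 0 < phi₂ (coefA n f) (coefB n f κ) s ∧ s < 1 ∧ 0 < s := by
    have h1 := (hasDerivAt_iff_tendsto_slope.1 hd).eventually (lt_mem_nhds (hf.coefA_pos n 0))
    have h2 : ∀ᶠ s in 𝓝[>] (0 : ℝ), 0 < slope (phi₂ (coefA n f) (coefB n f κ)) 0 s :=
      h1.filter_mono (nhdsWithin_mono _ fun x hx => ne_of_gt hx)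
    obtain ⟨s, h3, h4, h5⟩ := (h2.and ((Ioo_mem_nhdsGT one_pos))).exists
    refine ⟨s, ?_, h5, h4⟩
    rw [slope_def_field, phi₂_zero, sub_zero, sub_zero] at h3
    exact (div_pos_iff_of_pos_right h4).1 h3
  obtain ⟨t, ht, ht0⟩ := intermediate_value_Icc' hs1.le
    (hsys.continuous_phi₂.continuousOn) ⟨hneg, hs.le⟩
  have := hc.boundary_form_pos hf hsys.hasDerivAt_phi₂ hsys.hasDerivAt_psi₂
    (t := t) ⟨hs0.trans_le ht.1, ht.2⟩ (Or.inr ht0) (by rw [ht0, phi₂_zero]) (Or.inr (by simp))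
  simp [ht0] at this

/-- The energy of the solution equal to 1 at both ends is `z(1) - z(0) > 0`. Multiplied by `φ₂(1) >
0` it becomes `trace - 2`, by the Wronskian identity. -/
theorem IsCoercive.two_lt_trc (hc : IsCoercive n f κ) (hf : IsPositive f) :
    2 < trc (coefA n f) (coefB n f κ) := by
  have hsys := hf.isPeriodicSystem n κ
  have hp := hc.phi₂_one_pos hf
  have hw := hsys.wronskian 1
  set φ₁ := phi₁ (coefA n f) (coefB n f κ)
  set φ₂ := phi₂ (coefA n f) (coefB n f κ)
  set ψ₁ := psi₁ (coefA n f) (coefB n f κ)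
  set ψ₂ := psi₂ (coefA n f) (coefB n f κ)
  -- The slope parameter for which `φ₁ + m φ₂` takes the value 1 again at 1.
  set m := (1 - φ₁ 1) / φ₂ 1 with hm
  have hmφ : m * φ₂ 1 = 1 - φ₁ 1 := div_mul_cancel₀ _ hp.ne'
  have h1 : φ₁ 0 = 1 := phi₁_zero _ _
  have h2 : φ₂ 0 = 0 := phi₂_zero _ _
  have h3 : ψ₁ 0 = 0 := psi₁_zero _ _
  have h4 : ψ₂ 0 = 1 := psi₂_zero _ _
  have key := hc.boundary_form_pos hf (v := fun r => φ₁ r + m * φ₂ r)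
    (z := fun r => ψ₁ r + m * ψ₂ r) (t := 1)
    (fun r => ((hsys.hasDerivAt_phi₁ r).add ((hsys.hasDerivAt_phi₂ r).const_mul m)).congr_deriv
      (by ring))
    (fun r => ((hsys.hasDerivAt_psi₁ r).add ((hsys.hasDerivAt_psi₂ r).const_mul m)).congr_deriv
      (by ring)) ⟨one_pos, le_rfl⟩ (Or.inl rfl) (by simp only [h1, h2]; linarith)
    (Or.inl (by simp only [h1, h2]; norm_num))
  simp only [h1, h2, h3, h4, hmφ] at key
  have h5 : 0 < (ψ₁ 1 + m * ψ₂ 1 - m) * φ₂ 1 := mul_pos (by linarith) hp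
  have h6 : (ψ₁ 1 + m * ψ₂ 1 - m) * φ₂ 1 = trc (coefA n f) (coefB n f κ) - 2 := by
    have : trc (coefA n f) (coefB n f κ) = φ₁ 1 + ψ₂ 1 := rfl
    rw [this]
    linear_combination (ψ₂ 1 - 1) * hmφ - hw
  linarith

end

/-! ### The Green's function and the potential in terms of the monodromy matrix. -/

theorem contDiff_two_of_hasDerivAt {v v' v'' : ℝ → ℝ} (h1 : ∀ r, HasDerivAt v (v' r) r)
    (h2 : ∀ r, HasDerivAt v' (v'' r) r) (hc : Continuous v'') : ContDiff ℝ 2 v := by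
  have e1 : deriv v = v' := funext fun r => (h1 r).deriv
  have e2 : deriv v' = v'' := funext fun r => (h2 r).deriv
  have hv' : ContDiff ℝ 1 v' :=
    contDiff_one_iff_deriv.2 ⟨fun r => (h2 r).differentiableAt, by rwa [e2]⟩
  exact (contDiff_succ_iff_deriv (n := 1)).2
    ⟨fun r => (h1 r).differentiableAt, by simp, by rwa [e1]⟩

/-- Two continuous functions on `[0,1]` with the same smooth moments agree. -/
theorem eqOn_of_forall_integral_mul_eq {g₁ g₂ : ℝ → ℝ} (h₁ : ContinuousOn g₁ (Icc 0 1))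
    (h₂ : ContinuousOn g₂ (Icc 0 1)) (H : ∀ h : ℝ → ℝ, ContDiff ℝ ∞ h →
      ∫ s in (0 : ℝ)..1, g₁ s * h s = ∫ s in (0 : ℝ)..1, g₂ s * h s) :
    EqOn g₁ g₂ (Icc 0 1) := by
  have hloc : LocallyIntegrableOn (fun s => g₁ s - g₂ s) (Ioo (0 : ℝ) 1) volume :=
    ((h₁.sub h₂).integrableOn_Icc.mono_set Ioo_subset_Icc_self).locallyIntegrableOn
  have hae := isOpen_Ioo.ae_eq_zero_of_integral_contDiff_smul_eq_zero hloc fun h hh _ hsupp => by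
    have i1 : IntervalIntegrable (fun s => g₁ s * h s) volume 0 1 :=
      (h₁.mul hh.continuous.continuousOn).intervalIntegrable_of_Icc zero_le_one
    have i2 : IntervalIntegrable (fun s => g₂ s * h s) volume 0 1 :=
      (h₂.mul hh.continuous.continuousOn).intervalIntegrable_of_Icc zero_le_one
    have e : ∫ s in (0 : ℝ)..1, h s • (g₁ s - g₂ s) = 0 := by
      refine Eq.trans ?_ (sub_eq_zero.2 (H h hh))
      rw [← intervalIntegral.integral_sub i1 i2]
      congr 1
      funext s
      rw [smul_eq_mul]
      ring
    rw [← e, intervalIntegral.integral_of_le zero_le_one,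
      setIntegral_eq_integral_of_forall_compl_eq_zero]
    intro s hs
    have : h s = 0 := by
      by_contra hne
      exact hs (Ioo_subset_Ioc_self (hsupp (subset_tsupport h hne)))
    rw [this, zero_smul]
  refine Measure.eqOn_Icc_of_ae_eq volume zero_ne_one ?_ h₁ h₂
  rw [← Measure.restrict_congr_set Ioo_ae_eq_Icc]
  filter_upwards [ae_restrict_of_ae hae, ae_restrict_mem measurableSet_Ioo] with s h3 h4
  exact sub_eq_zero.1 (h3 h4)

section

variable {n : ℕ} {f κ : PerC2}

theorem PerC2.hasDerivAt (f : PerC2) (r : ℝ) : HasDerivAt f (deriv f r) r :=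
  (f.contDiff.differentiable two_ne_zero r).hasDerivAt

theorem IsPositive.hasDerivAt_pow (hf : IsPositive f) (n : ℕ) (r : ℝ) :
    HasDerivAt (fun s => f s ^ n) (n * (deriv f r / f r) * f r ^ n) r := by
  refine ((f.hasDerivAt r).pow n).congr_deriv ?_
  have := (hf.pos r).ne'
  rcases n with _ | m
  · simp
  · rw [Nat.add_sub_cancel, pow_succ]
    field_simp

theorem IsPositive.hasDerivAt_coefA (hf : IsPositive f) (n : ℕ) (r : ℝ) :
    HasDerivAt (coefA n f) (-(n * (deriv f r / f r)) * coefA n f r) r := by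
  have hp := (hf.pow_pos n r).ne'
  refine ((hasDerivAt_const r (1 : ℝ)).div (hf.hasDerivAt_pow n r) hp).congr_deriv ?_
  simp only [coefA]
  field_simp
  ring

theorem IsPositive.continuous_logDeriv (hf : IsPositive f) (n : ℕ) :
    Continuous fun r => n * (deriv f r / f r) :=
  continuous_const.mul (f.contDiff_deriv.continuous.div f.continuous fun r => (hf.pos r).ne')

/-- Here `z` plays the role of `fⁿ v'`, and the system is the divergence form `-(fⁿ v')' + fⁿ κ v =
fⁿ h`. The extra function `u` is needed because the Green integral is identified with a solution
only on `[0,1]`. -/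
theorem IsPositive.isSolution_of_system (hf : IsPositive f) {h v z u : ℝ → ℝ} (hh : Continuous h)
    (hv : ∀ r, HasDerivAt v (coefA n f r * z r) r)
    (hz : ∀ r, HasDerivAt z (coefB n f κ r * v r - f r ^ n * h r) r) (hv01 : v 0 = v 1)
    (hz01 : z 0 = z 1) (huv : EqOn u v (Icc 0 1)) : IsSolution n f κ h u := by
  have hsys := hf.isPeriodicSystem n κ
  have hv2 : ∀ r, HasDerivAt (fun r => coefA n f r * z r)
      (-(n * (deriv f r / f r)) * (coefA n f r * z r) + κ r * v r - h r) r := fun r => by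
    refine ((hf.hasDerivAt_coefA n r).mul (hz r)).congr_deriv ?_
    have := (hf.pow_pos n r).ne'
    simp only [coefA, coefB]
    field_simp
    ring
  have cv : Continuous v := continuous_iff_continuousAt.2 fun r => (hv r).continuousAt
  have cz : Continuous z := continuous_iff_continuousAt.2 fun r => (hz r).continuousAt
  have hC2 : ContDiff ℝ 2 v := contDiff_two_of_hasDerivAt hv hv2
    ((((hf.continuous_logDeriv n).neg.mul (hsys.continuous_left.mul cz)).add
      (κ.continuous.mul cv)).sub hh)
  have h01 : (0 : ℝ) ∈ Icc (0 : ℝ) 1 := ⟨le_rfl, zero_le_one⟩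
  have h11 : (1 : ℝ) ∈ Icc (0 : ℝ) 1 := ⟨zero_le_one, le_rfl⟩
  have hdw : ∀ r ∈ Icc (0 : ℝ) 1, derivWithin u (Icc 0 1) r = coefA n f r * z r := fun r hr =>
    ((hv r).hasDerivWithinAt.congr_of_mem huv hr).derivWithin (uniqueDiffOn_Icc one_pos r hr)
  have huv' : ∀ r ∈ Ioo (0 : ℝ) 1, u =ᶠ[𝓝 r] v := fun r hr =>
    huv.eventuallyEq_of_mem (Icc_mem_nhds hr.1 hr.2)
  refine ⟨hC2.contDiffOn.congr huv, fun r hr => ?_, ?_, ?_⟩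
  · have e : deriv u =ᶠ[𝓝 r] fun r => coefA n f r * z r := by
      filter_upwards [isOpen_Ioo.mem_nhds hr] with s hs
      rw [(huv' s hs).deriv_eq, (hv s).deriv]
    rw [e.deriv_eq, (hv2 r).deriv, e.eq_of_nhds, huv (Ioo_subset_Icc_self hr)]
    ring
  · rw [huv h01, huv h11, hv01]
  · rw [hdw 0 h01, hdw 1 h11, hz01]
    have := hsys.periodic_left 0
    rw [zero_add] at this
    rw [this]

/-- A solution of the boundary value problem satisfies the first order system on `[0,1]`. -/
theorem IsSolution.system (hf : IsPositive f) {h v : ℝ → ℝ} (hh : Continuous h)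
    (hv : IsSolution n f κ h v) {r : ℝ} (hr : r ∈ Icc (0 : ℝ) 1) :
    HasDerivWithinAt v (coefA n f r * (f r ^ n * derivWithin v (Icc 0 1) r)) (Icc 0 1) r ∧
    HasDerivWithinAt (fun r => f r ^ n * derivWithin v (Icc 0 1) r)
      (coefB n f κ r * v r - f r ^ n * h r) (Icc 0 1) r := by
  have hU := uniqueDiffOn_Icc (one_pos (α := ℝ))
  have hC := hv.contDiffOn
  have hC1 : ContDiffOn ℝ 1 (derivWithin v (Icc 0 1)) (Icc 0 1) :=
    hC.derivWithin hU (by norm_num)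
  have hC0 : ContinuousOn (derivWithin (derivWithin v (Icc 0 1)) (Icc 0 1)) (Icc 0 1) :=
    hC1.continuousOn_derivWithin hU le_rfl
  have d1 : HasDerivWithinAt v (derivWithin v (Icc 0 1) r) (Icc 0 1) r :=
    (hC.differentiableOn two_ne_zero r hr).hasDerivWithinAt
  have d2 := (hC1.differentiableOn one_ne_zero r hr).hasDerivWithinAt
  have heq : EqOn (derivWithin (derivWithin v (Icc 0 1)) (Icc 0 1))
      (fun r => -(n * (deriv f r / f r)) * derivWithin v (Icc 0 1) r + κ r * v r - h r)
      (Icc 0 1) := by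
    have hcl : closure (Ioo (0 : ℝ) 1) = Icc 0 1 := closure_Ioo zero_ne_one
    have hIoo : EqOn (derivWithin (derivWithin v (Icc 0 1)) (Icc 0 1))
        (fun r => -(n * (deriv f r / f r)) * derivWithin v (Icc 0 1) r + κ r * v r - h r)
        (Ioo 0 1) := fun s hs => by
      have e : derivWithin v (Icc 0 1) =ᶠ[𝓝 s] deriv v := by
        filter_upwards [isOpen_Ioo.mem_nhds hs] with x hx
        exact derivWithin_of_mem_nhds (Icc_mem_nhds hx.1 hx.2)
      have := hv.equation s hs
      rw [derivWithin_of_mem_nhds (Icc_mem_nhds hs.1 hs.2), e.deriv_eq]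
      simp only [e.eq_of_nhds]
      linarith
    -- The equation is given only in the open interval; continuity of both sides carries it to the
    -- end points.
    refine hIoo.of_subset_closure hC0 ?_ Ioo_subset_Icc_self hcl.symm.subset
    exact (((hf.continuous_logDeriv n).neg.continuousOn.mul hC1.continuousOn).add
      (κ.continuous.continuousOn.mul hC.continuousOn)).sub hh.continuousOn
  have hp := (hf.pow_pos n r).ne'
  refine ⟨d1.congr_deriv ?_, ((hf.hasDerivAt_pow n r).hasDerivWithinAt.mul d2).congr_deriv ?_⟩
  · simp only [coefA]
    field_simp
  · rw [heq hr]
    simp only [coefB]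
    ring

/-- The initial data of the difference of two solutions form a vector fixed by `Φ(1)`, and `det
(Φ(1) - 1) = 2 - trace ≠ 0`. -/
theorem IsSolution.eqOn (hf : IsPositive f) (ht : trc (coefA n f) (coefB n f κ) ≠ 2)
    {h v w : ℝ → ℝ} (hh : Continuous h) (hv : IsSolution n f κ h v) (hw : IsSolution n f κ h w) :
    EqOn v w (Icc 0 1) := by
  intro r hr
  have hsys := hf.isPeriodicSystem n κ
  have h01 : (0 : ℝ) ∈ Icc (0 : ℝ) 1 := ⟨le_rfl, zero_le_one⟩
  have h11 : (1 : ℝ) ∈ Icc (0 : ℝ) 1 := ⟨zero_le_one, le_rfl⟩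
  have key := fun s hs => hsys.eq_of_hasDerivWithinAt (v := fun r => v r - w r)
    (z := fun r => f r ^ n * derivWithin v (Icc 0 1) r - f r ^ n * derivWithin w (Icc 0 1) r)
    (fun r hr => ((hv.system hf hh hr).1.sub (hw.system hf hh hr).1).congr_deriv (by ring))
    (fun r hr => ((hv.system hf hh hr).2.sub (hw.system hf hh hr).2).congr_deriv (by ring))
    (r := s) hs
  have hp : f 1 ^ n = f 0 ^ n := by
    have := f.periodic 0
    rw [zero_add] at this
    rw [this]
  obtain ⟨k1, k2⟩ := key 1 h11
  rw [hp, ← hv.boundary_deriv, ← hw.boundary_deriv] at k2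
  rw [← hv.boundary, ← hw.boundary] at k1
  obtain ⟨k3, -⟩ := key r hr
  have hW := hsys.wronskian 1
  simp only [trc] at ht
  generalize v 0 - w 0 = x at *
  generalize f 0 ^ n * derivWithin v (Icc 0 1) 0 - f 0 ^ n * derivWithin w (Icc 0 1) 0 = y at *
  have ht' : phi₁ (coefA n f) (coefB n f κ) 1 + psi₂ (coefA n f) (coefB n f κ) 1 - 2 ≠ 0 :=
    sub_ne_zero.2 ht
  have hx : x = 0 := by
    refine (mul_eq_zero.1 ?_).resolve_left ht'
    linear_combination (psi₂ (coefA n f) (coefB n f κ) 1 - 1) * k1 -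
      phi₂ (coefA n f) (coefB n f κ) 1 * k2 + x * hW
  have hy : y = 0 := by
    refine (mul_eq_zero.1 ?_).resolve_left ht'
    linear_combination (phi₁ (coefA n f) (coefB n f κ) 1 - 1) * k2 -
      psi₁ (coefA n f) (coefB n f κ) 1 * k1 + y * hW
  rw [hx, hy] at k3
  linarith

/-- Uniqueness of solutions gives both kernels the same smooth moments in `s`. Hence the arbitrarily
chosen `green` may be replaced by an explicit kernel on `[0,1]²`. -/
theorem IsGreen.eqOn {G G' : ℝ → ℝ → ℝ} (hG : IsGreen n f κ G) (hG' : IsGreen n f κ G')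
    {r s : ℝ} (hr : r ∈ Icc (0 : ℝ) 1) (hs : s ∈ Icc (0 : ℝ) 1) : G r s = G' r s := by
  have hc : ∀ K : ℝ → ℝ → ℝ, IsGreen n f κ K → ContinuousOn (K r) (Icc 0 1) := fun K hK =>
    hK.continuousOn.comp (f := fun s : ℝ => (r, s)) (by fun_prop) fun s hs => ⟨hr, hs⟩
  exact eqOn_of_forall_integral_mul_eq (hc G hG) (hc G' hG')
    (fun h hh => hG'.unique h hh _ (hG.solves h hh) hr) hs

/-- The Green's function in terms of the fundamental matrix. -/
def greenKernel (n : ℕ) (f κ : PerC2) (r s : ℝ) : ℝ :=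
  let a := coefA n f
  let b := coefB n f κ
  f s ^ n *
    ((phi₁ a b r * (phi₂ a b 1 * phi₁ a b s - (phi₁ a b 1 - 1) * phi₂ a b s) +
      phi₂ a b r * ((psi₂ a b 1 - 1) * phi₁ a b s - psi₁ a b 1 * phi₂ a b s)) / (trc a b - 2) -
    (phi₂ a b (max r s) * phi₁ a b s - phi₁ a b (max r s) * phi₂ a b s))

/-- Variation of constants: the bracket with `max r s` gives the particular solution with zero data
at 0 and vanishes for `s ≥ r`, which makes the kernel visibly continuous. The fraction is the
homogeneous solution that restores periodicity. -/
theorem isGreen_greenKernel (hf : IsPositive f) (ht : trc (coefA n f) (coefB n f κ) ≠ 2) :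
    IsGreen n f κ (greenKernel n f κ) := by
  have hsys := hf.isPeriodicSystem n κ
  have hW := hsys.wronskian
  have cp : Continuous fun s => f s ^ n := f.continuous.pow n
  have c1 := hsys.continuous_phi₁
  have c2 := hsys.continuous_phi₂
  have hd1 := hsys.hasDerivAt_phi₁
  have hd2 := hsys.hasDerivAt_phi₂
  have hd3 := hsys.hasDerivAt_psi₁
  have hd4 := hsys.hasDerivAt_psi₂
  have i1 : phi₁ (coefA n f) (coefB n f κ) 0 = 1 := phi₁_zero _ _
  have i2 : phi₂ (coefA n f) (coefB n f κ) 0 = 0 := phi₂_zero _ _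
  have i3 : psi₁ (coefA n f) (coefB n f κ) 0 = 0 := psi₁_zero _ _
  have i4 : psi₂ (coefA n f) (coefB n f κ) 0 = 1 := psi₂_zero _ _
  have htr : trc (coefA n f) (coefB n f κ) =
    phi₁ (coefA n f) (coefB n f κ) 1 + psi₂ (coefA n f) (coefB n f κ) 1 := rfl
  have hker : greenKernel n f κ = fun r s => f s ^ n *
    ((phi₁ (coefA n f) (coefB n f κ) r *
        (phi₂ (coefA n f) (coefB n f κ) 1 * phi₁ (coefA n f) (coefB n f κ) s -
        (phi₁ (coefA n f) (coefB n f κ) 1 - 1) * phi₂ (coefA n f) (coefB n f κ) s) +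
      phi₂ (coefA n f) (coefB n f κ) r *
        ((psi₂ (coefA n f) (coefB n f κ) 1 - 1) * phi₁ (coefA n f) (coefB n f κ) s -
        psi₁ (coefA n f) (coefB n f κ) 1 * phi₂ (coefA n f) (coefB n f κ) s)) /
        (trc (coefA n f) (coefB n f κ) - 2) -
    (phi₂ (coefA n f) (coefB n f κ) (max r s) * phi₁ (coefA n f) (coefB n f κ) s -
      phi₁ (coefA n f) (coefB n f κ) (max r s) * phi₂ (coefA n f) (coefB n f κ) s)) := rfl
  have ht' : trc (coefA n f) (coefB n f κ) - 2 ≠ 0 := sub_ne_zero.2 ht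
  have hsolves : ∀ h : ℝ → ℝ, ContDiff ℝ ∞ h →
      IsSolution n f κ h (fun r => ∫ s in (0 : ℝ)..1, greenKernel n f κ r s * h s) := by
    intro h hh
    rw [hker]
    generalize trc (coefA n f) (coefB n f κ) = τ at *
    generalize phi₁ (coefA n f) (coefB n f κ) = φ₁ at *
    generalize phi₂ (coefA n f) (coefB n f κ) = φ₂ at *
    generalize psi₁ (coefA n f) (coefB n f κ) = ψ₁ at *
    generalize psi₂ (coefA n f) (coefB n f κ) = ψ₂ at *
    have ch := hh.continuous
    have cf := f.continuous
    set g₁ : ℝ → ℝ := fun s => f s ^ n * φ₁ s * h s with hg₁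
    set g₂ : ℝ → ℝ := fun s => f s ^ n * φ₂ s * h s with hg₂
    have cg₁ : Continuous g₁ := (cp.mul c1).mul ch
    have cg₂ : Continuous g₂ := (cp.mul c2).mul ch
    set H₁ : ℝ → ℝ := fun r => ∫ s in (0 : ℝ)..r, g₁ s with hH₁
    set H₂ : ℝ → ℝ := fun r => ∫ s in (0 : ℝ)..r, g₂ s with hH₂
    have dH₁ : ∀ r, HasDerivAt H₁ (g₁ r) r := fun r =>
      (cg₁.integral_hasStrictDerivAt 0 r).hasDerivAt
    have dH₂ : ∀ r, HasDerivAt H₂ (g₂ r) r := fun r =>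
      (cg₂.integral_hasStrictDerivAt 0 r).hasDerivAt
    have H₁0 : H₁ 0 = 0 := intervalIntegral.integral_same
    have H₂0 : H₂ 0 = 0 := intervalIntegral.integral_same
    -- Cramer's rule for the initial data `(x, y)` that make both `v` and `z` periodic.
    set x := (φ₂ 1 * H₁ 1 - (φ₁ 1 - 1) * H₂ 1) / (τ - 2) with hx
    set y := ((ψ₂ 1 - 1) * H₁ 1 - ψ₁ 1 * H₂ 1) / (τ - 2) with hy
    have hx' : x * (τ - 2) = φ₂ 1 * H₁ 1 - (φ₁ 1 - 1) * H₂ 1 := div_mul_cancel₀ _ ht'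
    have hy' : y * (τ - 2) = (ψ₂ 1 - 1) * H₁ 1 - ψ₁ 1 * H₂ 1 := div_mul_cancel₀ _ ht'
    refine hf.isSolution_of_system ch
      (v := fun r => φ₁ r * x + φ₂ r * y - (φ₂ r * H₁ r - φ₁ r * H₂ r))
      (z := fun r => ψ₁ r * x + ψ₂ r * y - (ψ₂ r * H₁ r - ψ₁ r * H₂ r))
      (fun r => ((((hd1 r).mul_const x).add ((hd2 r).mul_const y)).sub
        (((hd2 r).mul (dH₁ r)).sub ((hd1 r).mul (dH₂ r)))).congr_deriv
        (by simp only [hg₁, hg₂]; ring))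
      (fun r => ((((hd3 r).mul_const x).add ((hd4 r).mul_const y)).sub
        (((hd4 r).mul (dH₁ r)).sub ((hd3 r).mul (dH₂ r)))).congr_deriv ?_) ?_ ?_ ?_
    · simp only [hg₁, hg₂]
      linear_combination (-(f r ^ n * h r)) * hW r
    · simp only [H₁0, H₂0, i1, i2]
      apply mul_right_cancel₀ ht'
      linear_combination (1 - φ₁ 1) * hx' - φ₂ 1 * hy' - H₂ 1 * hW 1 +
        (φ₂ 1 * H₁ 1 - φ₁ 1 * H₂ 1) * htr
    · simp only [H₁0, H₂0, i3, i4]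
      apply mul_right_cancel₀ ht'
      linear_combination (1 - ψ₂ 1) * hy' - ψ₁ 1 * hx' + H₁ 1 * hW 1 +
        (ψ₂ 1 * H₁ 1 - ψ₁ 1 * H₂ 1) * htr
    · intro r hr
      have hsplit : ∀ c₁ c₂ s t : ℝ, ∫ s in s..t, (c₁ * g₁ s + c₂ * g₂ s) =
          c₁ * (∫ s in s..t, g₁ s) + c₂ * ∫ s in s..t, g₂ s := fun c₁ c₂ s t => by
        rw [intervalIntegral.integral_add, intervalIntegral.integral_const_mul,
          intervalIntegral.integral_const_mul]
        · exact (cg₁.const_mul _).intervalIntegrable _ _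
        · exact (cg₂.const_mul _).intervalIntegrable _ _
      have htail : ∀ g : ℝ → ℝ, Continuous g →
          ∫ s in r..1, g s = (∫ s in (0 : ℝ)..1, g s) - ∫ s in (0 : ℝ)..r, g s := fun g hg =>
        eq_sub_of_add_eq' (intervalIntegral.integral_add_adjacent_intervals
          (hg.intervalIntegrable _ _) (hg.intervalIntegrable _ _))
      -- `A₁` and `A₂` are the coefficients of `g₁(s)` and `g₂(s)` for `s ≥ r`; for `s ≤ r` the
      -- bracket adds `-φ₂(r)` and `φ₁(r)`.
      set A₁ := (φ₁ r * φ₂ 1 + φ₂ r * (ψ₂ 1 - 1)) / (τ - 2) with hA₁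
      set A₂ := (-(φ₁ r * (φ₁ 1 - 1)) - φ₂ r * ψ₁ 1) / (τ - 2) with hA₂
      have e1 : ∫ s in (0 : ℝ)..r, (f s ^ n * ((φ₁ r * (φ₂ 1 * φ₁ s - (φ₁ 1 - 1) * φ₂ s) +
          φ₂ r * ((ψ₂ 1 - 1) * φ₁ s - ψ₁ 1 * φ₂ s)) / (τ - 2) -
          (φ₂ (max r s) * φ₁ s - φ₁ (max r s) * φ₂ s))) * h s =
          (A₁ - φ₂ r) * H₁ r + (A₂ + φ₁ r) * H₂ r := by
        rw [← hsplit]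
        refine intervalIntegral.integral_congr fun s hs => ?_
        rw [uIcc_of_le hr.1] at hs
        simp only [max_eq_left hs.2, hg₁, hg₂, hA₁, hA₂]
        field_simp
        ring
      have e2 : ∫ s in r..1, (f s ^ n * ((φ₁ r * (φ₂ 1 * φ₁ s - (φ₁ 1 - 1) * φ₂ s) +
          φ₂ r * ((ψ₂ 1 - 1) * φ₁ s - ψ₁ 1 * φ₂ s)) / (τ - 2) -
          (φ₂ (max r s) * φ₁ s - φ₁ (max r s) * φ₂ s))) * h s =
          A₁ * (H₁ 1 - H₁ r) + A₂ * (H₂ 1 - H₂ r) := by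
        rw [← htail g₁ cg₁, ← htail g₂ cg₂, ← hsplit]
        refine intervalIntegral.integral_congr fun s hs => ?_
        rw [uIcc_of_le hr.2] at hs
        simp only [max_eq_right hs.1, hg₁, hg₂, hA₁, hA₂]
        field_simp
        ring
      have cF : Continuous fun s => (f s ^ n * ((φ₁ r * (φ₂ 1 * φ₁ s - (φ₁ 1 - 1) * φ₂ s) +
          φ₂ r * ((ψ₂ 1 - 1) * φ₁ s - ψ₁ 1 * φ₂ s)) / (τ - 2) -
          (φ₂ (max r s) * φ₁ s - φ₁ (max r s) * φ₂ s))) * h s := by fun_prop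
      simp only
      rw [← intervalIntegral.integral_add_adjacent_intervals (cF.intervalIntegrable 0 r)
        (cF.intervalIntegrable r 1), e1, e2, hx, hy, hA₁, hA₂]
      field_simp
      ring
  exact {
    continuousOn := by
      rw [hker]
      have cf := f.continuous
      refine Continuous.continuousOn ?_
      fun_prop
    solves := hsolves
    unique := fun h hh v hv => hv.eqOn hf ht hh.continuous (hsolves h hh) }

theorem IsPositive.isGreen_green (hf : IsPositive f) (ht : trc (coefA n f) (coefB n f κ) ≠ 2) :
    IsGreen n f κ (green n f κ) :=
  Classical.epsilon_spec (p := IsGreen n f κ) ⟨_, isGreen_greenKernel hf ht⟩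

/-- On the diagonal both `Γ` and the `max` bracket vanish. What remains is a quadratic form in
`φ₁(r), φ₂(r)`, which the Floquet relation identifies with `monB`. -/
theorem IsPositive.potential_eq (hf : IsPositive f) (ht : trc (coefA n f) (coefB n f κ) ≠ 2) :
    EqOn (potential n f κ)
      (fun r => monB (coefA n f) (coefB n f κ) r / (trc (coefA n f) (coefB n f κ) - 2))
      (Icc 0 1) := by
  intro r hr
  have hp := (hf.pow_pos n r).ne'
  obtain ⟨h1, h2⟩ := (hf.isPeriodicSystem n κ).floquet hr
  have ht' : trc (coefA n f) (coefB n f κ) - 2 ≠ 0 := sub_ne_zero.2 ht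
  simp only [potential, regularPart, singularPart, lt_irrefl, if_false, sub_zero]
  rw [(hf.isGreen_green ht).eqOn (isGreen_greenKernel hf ht) hr hr]
  simp only [greenKernel, max_self, monB, h1, h2]
  field_simp
  ring

theorem IsPositive.isAdmissible (hf : IsPositive f) (hc : IsCoercive n f κ) :
    IsAdmissible n f κ := by
  have ht := (hc.two_lt_trc hf).ne'
  have hsys := hf.isPeriodicSystem n κ
  refine ⟨hf, hc, hf.isGreen_green ht, ContDiffOn.congr (ContDiff.contDiffOn ?_)
    (hf.potential_eq ht)⟩
  refine ContDiff.div_const (contDiff_two_of_hasDerivAt hsys.hasDerivAt_monB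
    (fun r => (hf.hasDerivAt_coefA n r).mul (hsys.hasDerivAt_gap r)) ?_) _
  have c1 : Continuous (gap (coefA n f) (coefB n f κ)) :=
    continuous_iff_continuousAt.2 fun r => (hsys.hasDerivAt_gap r).continuousAt
  have c2 : Continuous (monB (coefA n f) (coefB n f κ)) :=
    continuous_iff_continuousAt.2 fun r => (hsys.hasDerivAt_monB r).continuousAt
  have c3 : Continuous (monC (coefA n f) (coefB n f κ)) :=
    continuous_iff_continuousAt.2 fun r => (hsys.hasDerivAt_monC r).continuousAt
  have c4 := hsys.continuous_left
  have c5 := hsys.continuous_right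
  have c6 := hf.continuous_logDeriv n
  fun_prop

/-- The critical points of the potential are the zeros of the diagonal gap of the monodromy
matrix, and they are non-degenerate if these zeros are simple. -/
theorem IsPositive.allCriticalPointsNondegenerate (hf : IsPositive f) (hc : IsCoercive n f κ)
    (H : ∀ r ∈ Icc (0 : ℝ) 1, gap (coefA n f) (coefB n f κ) r = 0 →
      2 * (coefB n f κ r * monB (coefA n f) (coefB n f κ) r -
        coefA n f r * monC (coefA n f) (coefB n f κ) r) ≠ 0) :
    AllCriticalPointsNondegenerate (potential n f κ) := by
  have ht := (hc.two_lt_trc hf).ne'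
  have ht' : trc (coefA n f) (coefB n f κ) - 2 ≠ 0 := sub_ne_zero.2 ht
  have hsys := hf.isPeriodicSystem n κ
  have e1 : EqOn (derivWithin (potential n f κ) (Icc 0 1))
      (fun r => coefA n f r * gap (coefA n f) (coefB n f κ) r /
        (trc (coefA n f) (coefB n f κ) - 2)) (Icc 0 1) := fun r hr =>
    (((hsys.hasDerivAt_monB r).div_const _).hasDerivWithinAt.congr_of_mem
      (hf.potential_eq ht) hr).derivWithin (uniqueDiffOn_Icc one_pos r hr)
  intro r hr h0
  have ha := (hf.coefA_pos n r).ne'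
  rw [e1 hr, div_eq_zero_iff, or_iff_left ht', mul_eq_zero, or_iff_right ha] at h0
  rw [((((hf.hasDerivAt_coefA n r).mul (hsys.hasDerivAt_gap r)).div_const
    _).hasDerivWithinAt.congr_of_mem e1 hr).derivWithin (uniqueDiffOn_Icc one_pos r hr),
    h0, mul_zero, zero_add]
  exact div_ne_zero (mul_ne_zero ha (H r hr h0)) ht'

end

/-! ### Joint continuity of evaluation and openness of coercivity. -/

theorem PerC2.abs_apply_le_norm (f : PerC2) (s : ℝ) : |f s| ≤ ‖f‖ := by
  obtain ⟨y, hy, hxy⟩ := f.periodic.exists_mem_Ico₀ one_pos s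
  rw [hxy]
  refine le_trans ?_ (f.jet_le_norm (Ico_subset_Icc_self hy))
  unfold jet
  linarith [abs_nonneg (deriv f y), abs_nonneg (deriv (deriv f) y)]

theorem PerC2.continuous_eval : Continuous fun q : PerC2 × ℝ => q.1 q.2 := by
  refine continuous_iff_continuousAt.2 fun ⟨f, s⟩ => ?_
  have h1 : Tendsto (fun q : PerC2 × ℝ => (q.1 - f : PerC2) q.2) (𝓝 (f, s)) (𝓝 0) := by
    refine squeeze_zero_norm (fun q => PerC2.abs_apply_le_norm (q.1 - f) q.2) ?_
    have : Continuous fun q : PerC2 × ℝ => ‖q.1 - f‖ := by fun_prop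
    simpa using this.tendsto (f, s)
  have h2 : Tendsto (fun q : PerC2 × ℝ => f q.2) (𝓝 (f, s)) (𝓝 (f s)) :=
    (f.continuous.comp continuous_snd).tendsto (f, s)
  have h3 := h1.add h2
  rw [zero_add] at h3
  refine h3.congr fun q => ?_
  have : (q.1 - f : PerC2) q.2 = q.1 q.2 - f q.2 := rfl
  rw [this]
  ring

/-- The pairs `(f, κ)` with `f` positive and `κ` coercive for `f`. -/
def coercivePairs (n : ℕ) : Set (PerC2 × PerC2) := {θ | IsPositive θ.1 ∧ IsCoercive n θ.1 θ.2}

theorem eventually_forall_Icc_abs_sub_le {Θ : Type*} [TopologicalSpace Θ] {g : Θ → ℝ → ℝ}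
    (hg : Continuous fun q : Θ × ℝ => g q.1 q.2) (θ₀ : Θ) {ε : ℝ} (hε : 0 < ε) :
    ∀ᶠ θ in 𝓝 θ₀, ∀ s ∈ Icc (0 : ℝ) 1, |g θ s - g θ₀ s| ≤ ε := by
  refine isCompact_Icc.eventually_forall_of_forall_eventually fun s _ => ?_
  have hc : Continuous fun q : Θ × ℝ => |g q.1 q.2 - g θ₀ q.2| :=
    (hg.sub (hg.comp (by fun_prop : Continuous fun q : Θ × ℝ => (θ₀, q.2)))).abs
  exact (hc.continuousAt.eventually_lt continuousAt_const (by simpa)).mono fun _ h => le_of_lt h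

/-- Coefficients `fⁿ` and `fⁿ κ` that move by at most `c/2` uniformly change the quadratic form by
at most `c/2` times the squared `W^{1,2}` norm, so half of the coercivity constant survives. -/
theorem isOpen_coercivePairs (n : ℕ) : IsOpen (coercivePairs n) := by
  refine isOpen_iff_mem_nhds.2 fun ⟨f₀, κ₀⟩ ⟨hpos, c, hc, H⟩ => ?_
  have e1 : Continuous fun q : (PerC2 × PerC2) × ℝ => q.1.1 q.2 :=
    PerC2.continuous_eval.comp
      (by fun_prop : Continuous fun q : (PerC2 × PerC2) × ℝ => (q.1.1, q.2))
  have e2 : Continuous fun q : (PerC2 × PerC2) × ℝ => q.1.2 q.2 :=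
    PerC2.continuous_eval.comp
      (by fun_prop : Continuous fun q : (PerC2 × PerC2) × ℝ => (q.1.2, q.2))
  have h1 : ∀ᶠ θ in 𝓝 (f₀, κ₀), ∀ s ∈ Icc (0 : ℝ) 1, 0 < θ.1 s :=
    isCompact_Icc.eventually_forall_of_forall_eventually fun s hs =>
      continuousAt_const.eventually_lt e1.continuousAt (hpos s hs)
  have h2 := eventually_forall_Icc_abs_sub_le (g := fun θ : PerC2 × PerC2 => fun s => θ.1 s ^ n)
    (e1.pow n) (f₀, κ₀) (half_pos hc)
  have h3 := eventually_forall_Icc_abs_sub_le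
    (g := fun θ : PerC2 × PerC2 => fun s => θ.1 s ^ n * θ.2 s)
    ((e1.pow n).mul e2) (f₀, κ₀) (half_pos hc)
  filter_upwards [h1, h2, h3] with ⟨f, κ⟩ k1 k2 k3
  refine ⟨k1, c / 2, half_pos hc, fun v w hw hv hv01 => ?_⟩
  have cv : ContinuousOn v (Icc 0 1) := by
    have hwi : IntegrableOn w (Icc 0 1) := hw.integrable one_le_two
    have := intervalIntegral.continuousOn_primitive_interval
      (a := (0 : ℝ)) (b := 1) (f := w) (μ := volume) (by rwa [uIcc_of_le zero_le_one])
    rw [uIcc_of_le zero_le_one] at this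
    exact (continuousOn_const.add this).congr hv
  have iw : IntervalIntegrable (fun x => w x ^ 2) volume 0 1 := by
    rw [intervalIntegrable_iff_integrableOn_Icc_of_le zero_le_one]
    exact hw.integrable_sq
  have iv : IntervalIntegrable (fun x => v x ^ 2) volume 0 1 :=
    (cv.pow 2).intervalIntegrable_of_Icc zero_le_one
  have ig : ∀ f κ : PerC2, IntervalIntegrable (fun x => f x ^ n * (w x ^ 2 + κ x * v x ^ 2))
      volume 0 1 := fun f κ =>
    (iw.add (iv.continuousOn_mul κ.continuous.continuousOn)).continuousOn_mul
      (f.continuous.pow n).continuousOn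
  have key := H v w hw hv hv01
  have hle : ∫ x in (0 : ℝ)..1, f₀ x ^ n * (w x ^ 2 + κ₀ x * v x ^ 2) ≤
      ∫ x in (0 : ℝ)..1, (f x ^ n * (w x ^ 2 + κ x * v x ^ 2) + c / 2 * (w x ^ 2 + v x ^ 2)) := by
    refine intervalIntegral.integral_mono_on zero_le_one (ig _ _)
      ((ig _ _).add ((iw.add iv).const_mul _)) fun x hx => ?_
    have l1 := (abs_le.1 (k2 x hx)).1
    have l2 := (abs_le.1 (k3 x hx)).1
    simp only at l1 l2
    nlinarith [mul_nonneg (sub_nonneg.2 l1) (sq_nonneg (w x)),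
      mul_nonneg (sub_nonneg.2 l2) (sq_nonneg (v x))]
  rw [intervalIntegral.integral_add (ig _ _) ((iw.add iv).const_mul _),
    intervalIntegral.integral_const_mul] at hle
  linarith

/-! ### Sard arguments: density of parameters with simple zeros. -/

/-- A one-parameter Sard lemma: if the parameter moves the values of `F` at a definite speed,
then some member of the family has only simple zeros. -/
theorem exists_forall_simple_zero {F F' : ℝ → ℝ → ℝ} {η δ c d : ℝ} (hη : 0 < η) (hδ : 0 < δ)
    (hd : ∀ t ∈ Icc 0 η, ∀ r, HasDerivAt (F t) (F' t r) r)
    (hF' : ContinuousOn (fun q : ℝ × ℝ => F' q.1 q.2) (Icc 0 η ×ˢ Icc c d))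
    (hlip : ∀ t ∈ Icc 0 η, ∀ t' ∈ Icc 0 η, ∀ r ∈ Icc c d, δ * |t' - t| ≤ |F t' r - F t r|) :
    ∃ t ∈ Icc 0 η, ∀ r ∈ Icc c d, F t r = 0 → F' t r ≠ 0 := by
  by_contra! hbad
  -- A degenerate zero `ρ(t)` is picked for every `t`. No regularity of `ρ` is known, so the
  -- argument differentiates its inverse instead.
  choose! ρ hρ hρ0 hρ1 using hbad
  have hinj : InjOn ρ (Icc 0 η) := fun t ht t' ht' he => by
    have := hlip t ht t' ht' (ρ t) (hρ t ht)
    rw [hρ0 t ht, he, hρ0 t' ht', sub_zero, abs_zero] at this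
    have h0 : |t' - t| ≤ 0 := by
      by_contra! hc
      exact absurd (mul_pos hδ hc) this.not_gt
    linarith [abs_nonpos_iff.1 h0]
  set φ := Function.invFunOn ρ (Icc 0 η) with hφ
  have hφρ : ∀ t ∈ Icc 0 η, φ (ρ t) = t := fun t ht => hinj.leftInvOn_invFunOn ht
  have hunif := (isCompact_Icc.prod isCompact_Icc).uniformContinuousOn_of_continuous hF'
  rw [Metric.uniformContinuousOn_iff] at hunif
  -- The chain is `δ |t' - t| ≤ |F t' (ρ t) - F t' (ρ t')| ≤ ε δ |ρ t - ρ t'|`. The last step uses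
  -- that `F'` vanishes at `(t', ρ t')` and is uniformly continuous.
  have hder : ∀ x ∈ ρ '' Icc 0 η,
      HasFDerivWithinAt φ (0 : ℝ →L[ℝ] ℝ) (ρ '' Icc 0 η) x := by
    rintro _ ⟨t, ht, rfl⟩
    refine HasFDerivWithinAt.of_isLittleO (Asymptotics.isLittleO_iff.2 fun ε hε => ?_)
    obtain ⟨μ, hμ, hμ'⟩ := hunif (ε * δ) (mul_pos hε hδ)
    filter_upwards [self_mem_nhdsWithin,
      mem_nhdsWithin_of_mem_nhds (Metric.ball_mem_nhds (ρ t) hμ)] with _ hx hball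
    obtain ⟨t', ht', rfl⟩ := hx
    rw [hφρ t ht, hφρ t' ht', zero_apply, sub_zero, Real.norm_eq_abs,
      Real.norm_eq_abs]
    have hmv : ‖F t' (ρ t) - F t' (ρ t')‖ ≤ ε * δ * ‖ρ t - ρ t'‖ := by
      refine (convex_uIcc (ρ t') (ρ t)).norm_image_sub_le_of_norm_hasDerivWithin_le
        (f' := F' t') (fun y _ => (hd t' ht' y).hasDerivWithinAt) (fun y hy => ?_)
        left_mem_uIcc right_mem_uIcc
      have hyI : y ∈ Icc c d := uIcc_subset_Icc (hρ t' ht') (hρ t ht) hy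
      have hdist : dist (t', y) (t', ρ t') < μ := by
        rw [Prod.dist_eq, dist_self, max_lt_iff]
        refine ⟨hμ, lt_of_le_of_lt ?_ hball⟩
        rw [Real.dist_eq, Real.dist_eq, abs_sub_comm (ρ t')]
        exact abs_sub_left_of_mem_uIcc hy
      have := hμ' (t', y) ⟨ht', hyI⟩ (t', ρ t') ⟨ht', hρ t' ht'⟩ hdist
      simp only [hρ1 t' ht', dist_zero_right] at this
      exact this.le
    rw [hρ0 t' ht', sub_zero, Real.norm_eq_abs, Real.norm_eq_abs] at hmv
    have h1 := hlip t ht t' ht' (ρ t) (hρ t ht)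
    rw [hρ0 t ht, sub_zero] at h1
    rw [abs_sub_comm (ρ t')]
    refine le_of_mul_le_mul_left ?_ hδ
    linarith
  -- A map with zero derivative along a set has a null image of it; here that image is all of `[0,
  -- η]`.
  have hzero := addHaar_image_eq_zero_of_det_fderivWithin_eq_zero volume hder
    (fun _ _ => by simp)
  have himage : φ '' (ρ '' Icc 0 η) = Icc 0 η := by
    rw [image_image]
    exact (image_congr hφρ).trans (image_id' _)
  rw [himage, Real.volume_Icc, sub_zero, ENNReal.ofReal_eq_zero] at hzero
  exact hzero.not_gt hη

/-- Density of the parameters for which all zeros on `[0,1]` are simple. -/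
theorem mem_closure_simple_zeros {E : Type*} [NormedAddCommGroup E] [NormedSpace ℝ E] {X : Set E}
    (hX : IsOpen X) {F F' : E → ℝ → ℝ}
    (hF : ContinuousOn (fun q : E × ℝ => F q.1 q.2) (X ×ˢ univ))
    (hF' : ContinuousOn (fun q : E × ℝ => F' q.1 q.2) (X ×ˢ univ))
    (hd : ∀ θ ∈ X, ∀ r, HasDerivAt (F θ) (F' θ r) r)
    (htr : ∀ θ ∈ X, ∀ r ∈ Icc (0 : ℝ) 1, F θ r = 0 → ∃ φ : E, ∃ δ > 0,
      ∀ᶠ q : (E × E) × ℝ in 𝓝 ((θ, θ), r), ∀ t : ℝ, q.1.2 = q.1.1 + t • φ →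
        δ * |t| ≤ |F q.1.2 q.2 - F q.1.1 q.2|)
    {θ : E} (hθ : θ ∈ X) :
    θ ∈ closure {θ' ∈ X | ∀ r ∈ Icc (0 : ℝ) 1, F θ' r = 0 → F' θ' r ≠ 0} := by
  have hopen : IsOpen (X ×ˢ (univ : Set ℝ)) := hX.prod isOpen_univ
  have hFa : ∀ θ ∈ X, ∀ r, ContinuousAt (fun q : E × ℝ => F q.1 q.2) (θ, r) := fun θ hθ r =>
    hF.continuousAt (hopen.mem_nhds ⟨hθ, mem_univ _⟩)
  have hFa' : ∀ θ ∈ X, ∀ r, ContinuousAt (fun q : E × ℝ => F' q.1 q.2) (θ, r) := fun θ hθ r =>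
    hF'.continuousAt (hopen.mem_nhds ⟨hθ, mem_univ _⟩)
  -- Approximability is claimed for every parameter in `U`, not just for `θ`, since the parameter is
  -- perturbed once per interval of the finite cover.
  have hloc : ∀ r ∈ Icc (0 : ℝ) 1, ∃ I ∈ 𝓝 r, IsCompact I ∧ ∃ U : Set E, IsOpen U ∧ θ ∈ U ∧
      U ⊆ X ∧ U ⊆ closure {θ' | ∀ x ∈ I, F θ' x = 0 → F' θ' x ≠ 0} := by
    intro r hr
    by_cases h0 : F θ r = 0
    · obtain ⟨φ, δ, hδ, hev⟩ := htr θ hθ r hr h0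
      rw [nhds_prod_eq, nhds_prod_eq, Filter.eventually_prod_iff] at hev
      obtain ⟨P, hP, Q, hQ, hPQ⟩ := hev
      rw [← nhds_prod_eq] at hP
      obtain ⟨V, V', hV, hVθ, hV', hVθ', hVP⟩ := mem_nhds_prod_iff'.1 hP
      obtain ⟨μ, hμ, hμQ⟩ := Metric.nhds_basis_closedBall.mem_iff.1 hQ
      rw [Real.closedBall_eq_Icc] at hμQ
      refine ⟨Icc (r - μ) (r + μ), Icc_mem_nhds (by linarith) (by linarith), isCompact_Icc,
        V ∩ V' ∩ X, (hV.inter hV').inter hX, ⟨⟨hVθ, hVθ'⟩, hθ⟩, inter_subset_right,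
        fun θ₁ hθ₁ => mem_closure_iff.2 fun O hO hθO => ?_⟩
      have hW : IsOpen (V ∩ V' ∩ X ∩ O) := ((hV.inter hV').inter hX).inter hO
      have hpath : Continuous fun t : ℝ => θ₁ + t • φ := by fun_prop
      have hpre : (fun t : ℝ => θ₁ + t • φ) ⁻¹' (V ∩ V' ∩ X ∩ O) ∈ 𝓝 (0 : ℝ) :=
        (hW.preimage hpath).mem_nhds (by simpa using ⟨hθ₁, hθO⟩)
      obtain ⟨η, hη, hηW⟩ := Metric.nhds_basis_closedBall.mem_iff.1 hpre
      rw [Real.closedBall_eq_Icc] at hηW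
      have hmem : ∀ t ∈ Icc 0 η, θ₁ + t • φ ∈ V ∩ V' ∩ X ∩ O := fun t ht =>
        hηW ⟨by linarith [ht.1], by linarith [ht.2]⟩
      obtain ⟨t, ht, hgood⟩ := exists_forall_simple_zero (F := fun t => F (θ₁ + t • φ))
        (F' := fun t => F' (θ₁ + t • φ)) (c := r - μ) (d := r + μ) hη hδ
        (fun t ht x => hd _ (hmem t ht).1.2 x)
        (hF'.comp (f := fun q : ℝ × ℝ => (θ₁ + q.1 • φ, q.2)) (by fun_prop)
          fun q hq => ⟨(hmem q.1 hq.1).1.2, mem_univ _⟩)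
        (fun t ht t' ht' x hx => hPQ (x := (θ₁ + t • φ, θ₁ + t' • φ))
          (hVP ⟨(hmem t ht).1.1.1, (hmem t' ht').1.1.2⟩) (hμQ hx) (t' - t)
          (by simp only; rw [sub_smul]; abel))
      exact ⟨_, (hmem t ht).2, hgood⟩
    · have hne := (hFa θ hθ r).eventually_ne h0
      obtain ⟨V, hV, hVθ, W, hW, hWr, hVW⟩ : ∃ V : Set E, IsOpen V ∧ θ ∈ V ∧ ∃ W : Set ℝ,
          IsOpen W ∧ r ∈ W ∧ ∀ θ' ∈ V, ∀ x ∈ W, F θ' x ≠ 0 := by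
        obtain ⟨V, W, hV, hVθ, hW, hWr, h⟩ := mem_nhds_prod_iff'.1 hne
        exact ⟨V, hV, hVθ, W, hW, hWr, fun θ' h1 x h2 => h (mk_mem_prod h1 h2)⟩
      obtain ⟨μ, hμ, hμW⟩ := Metric.nhds_basis_closedBall.mem_iff.1 (hW.mem_nhds hWr)
      exact ⟨_, Metric.closedBall_mem_nhds r hμ, isCompact_closedBall r μ, V ∩ X, hV.inter hX,
        ⟨hVθ, hθ⟩, inter_subset_right, fun θ' hθ' => subset_closure fun x hx h =>
          absurd h (hVW θ' hθ'.1 x (hμW hx))⟩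
  choose! I hI hIc U hU hθU hUX hUcl using hloc
  have hfin : ∀ T : Finset ℝ, (∀ r ∈ T, r ∈ Icc (0 : ℝ) 1) → ∀ O : Set E, IsOpen O → θ ∈ O →
      ∃ θ' ∈ O ∩ X, ∀ r ∈ T, ∀ x ∈ I r, F θ' x = 0 → F' θ' x ≠ 0 := by
    intro T
    induction T using Finset.induction_on with
    | empty => exact fun _ O _ hθO => ⟨θ, ⟨hθO, hθ⟩, by simp⟩
    | insert r T hrT ih =>
      intro hT O hO hθO
      have hr := hT r (Finset.mem_insert_self r T)
      obtain ⟨θ₁, ⟨⟨h1, h2⟩, h3⟩, h4⟩ := ih (fun x hx => hT x (Finset.mem_insert_of_mem hx))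
        (O ∩ U r) (hO.inter (hU r hr)) ⟨hθO, hθU r hr⟩
      -- Having only simple zeros on a compact set is an open condition, so the next perturbation
      -- does not spoil the intervals already treated.
      have hstab : ∀ᶠ θ' in 𝓝 θ₁, ∀ y ∈ T, ∀ x ∈ I y, F θ' x = 0 → F' θ' x ≠ 0 := by
        refine (Finset.eventually_all T).2 fun y hy => ?_
        refine (hIc y (hT y (Finset.mem_insert_of_mem
          hy))).eventually_forall_of_forall_eventually fun x hx => ?_
        by_cases h0 : F θ₁ x = 0
        · exact ((hFa' θ₁ h3 x).eventually_ne (h4 y hy x hx h0)).mono fun _ h _ => h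
        · exact ((hFa θ₁ h3 x).eventually_ne h0).mono fun _ h h' => absurd h' h
      obtain ⟨W, hWs, hW, hWθ⟩ := mem_nhds_iff.1 hstab
      obtain ⟨θ₂, ⟨⟨k1, k2⟩, k3⟩, k4⟩ := mem_closure_iff.1 (hUcl r hr h2) (W ∩ O ∩ X)
        ((hW.inter hO).inter hX) ⟨⟨hWθ, h1⟩, h3⟩
      refine ⟨θ₂, ⟨k2, k3⟩, fun y hy => ?_⟩
      rcases Finset.mem_insert.1 hy with rfl | hy
      · exact k4
      · exact hWs k1 y hy
  obtain ⟨T, hT, hcov⟩ := isCompact_Icc.elim_nhds_subcover I hI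
  refine mem_closure_iff.2 fun O hO hθO => ?_
  obtain ⟨θ', ⟨h1, h2⟩, h3⟩ := hfin T hT O hO hθO
  refine ⟨θ', h1, h2, fun x hx => ?_⟩
  obtain ⟨r, hr, hxr⟩ := mem_iUnion₂.1 (hcov hx)
  exact h3 r hr x hxr

/-! ### Transfer matrices and the first variation of the gap. -/

section Transfer

variable (a b : ℝ → ℝ) (t s : ℝ)

/-- An entry of the transfer matrix `[[α, β], [γ, δ]] = Φ(t) Φ(s)⁻¹`. -/
def trfA : ℝ := phi₁ a b t * psi₂ a b s - phi₂ a b t * psi₁ a b s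
/-- An entry of the transfer matrix `[[α, β], [γ, δ]] = Φ(t) Φ(s)⁻¹`. -/
def trfB : ℝ := phi₂ a b t * phi₁ a b s - phi₁ a b t * phi₂ a b s
/-- An entry of the transfer matrix `[[α, β], [γ, δ]] = Φ(t) Φ(s)⁻¹`. -/
def trfC : ℝ := psi₁ a b t * psi₂ a b s - psi₂ a b t * psi₁ a b s
/-- An entry of the transfer matrix `[[α, β], [γ, δ]] = Φ(t) Φ(s)⁻¹`. -/
def trfD : ℝ := psi₂ a b t * phi₁ a b s - psi₁ a b t * phi₂ a b s

/-- The first variation of the gap at `r` with respect to the coefficient `b`: an entry of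
`T(s, r) diag(-1, 1) T'(r + 1, s)` for the transfer matrices `T` and `T'` of two systems. -/
def gapVarB (a b a' b' : ℝ → ℝ) (r s : ℝ) : ℝ :=
  trfB a b s r * trfD a' b' (r + 1) s - trfA a b s r * trfB a' b' (r + 1) s

/-- The first variation of the gap at `r` with respect to the coefficient `a`. -/
def gapVarA (a b a' b' : ℝ → ℝ) (r s : ℝ) : ℝ :=
  trfD a b s r * trfC a' b' (r + 1) s - trfC a b s r * trfA a' b' (r + 1) s

end Transfer

namespace IsPeriodicSystem

variable {a b a' b' : ℝ → ℝ}

section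

variable (h : IsPeriodicSystem a b) (t s : ℝ)
include h

/-- Entries of `∂ₜ T(t,s) = N(t) T(t,s)`; the companion lemma gives `∂ₛ T(t,s) = -T(t,s) N(s)`. -/
theorem hasDerivAt_trf_left :
    HasDerivAt (fun t => trfA a b t s) (a t * trfC a b t s) t ∧
    HasDerivAt (fun t => trfB a b t s) (a t * trfD a b t s) t ∧
    HasDerivAt (fun t => trfC a b t s) (b t * trfA a b t s) t ∧
    HasDerivAt (fun t => trfD a b t s) (b t * trfB a b t s) t := by
  have h1 := h.hasDerivAt_phi₁ t
  have h2 := h.hasDerivAt_phi₂ t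
  have h3 := h.hasDerivAt_psi₁ t
  have h4 := h.hasDerivAt_psi₂ t
  refine ⟨?_, ?_, ?_, ?_⟩
  · exact ((h1.mul_const _).sub (h2.mul_const _)).congr_deriv (by simp only [trfC]; ring)
  · exact ((h2.mul_const _).sub (h1.mul_const _)).congr_deriv (by simp only [trfD]; ring)
  · exact ((h3.mul_const _).sub (h4.mul_const _)).congr_deriv (by simp only [trfA]; ring)
  · exact ((h4.mul_const _).sub (h3.mul_const _)).congr_deriv (by simp only [trfB]; ring)

theorem hasDerivAt_trf_right :
    HasDerivAt (fun s => trfA a b t s) (-(trfB a b t s * b s)) s ∧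
    HasDerivAt (fun s => trfB a b t s) (-(trfA a b t s * a s)) s ∧
    HasDerivAt (fun s => trfC a b t s) (-(trfD a b t s * b s)) s ∧
    HasDerivAt (fun s => trfD a b t s) (-(trfC a b t s * a s)) s := by
  have h1 := h.hasDerivAt_phi₁ s
  have h2 := h.hasDerivAt_phi₂ s
  have h3 := h.hasDerivAt_psi₁ s
  have h4 := h.hasDerivAt_psi₂ s
  refine ⟨?_, ?_, ?_, ?_⟩
  · exact ((h4.const_mul _).sub (h3.const_mul _)).congr_deriv (by simp only [trfB]; ring)
  · exact ((h1.const_mul _).sub (h2.const_mul _)).congr_deriv (by simp only [trfA]; ring)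
  · exact ((h4.const_mul _).sub (h3.const_mul _)).congr_deriv (by simp only [trfD]; ring)
  · exact ((h1.const_mul _).sub (h2.const_mul _)).congr_deriv (by simp only [trfC]; ring)

theorem trf_self : trfA a b t t = 1 ∧ trfB a b t t = 0 ∧ trfC a b t t = 0 ∧ trfD a b t t = 1 := by
  have hw := h.wronskian t
  refine ⟨hw, ?_, ?_, ?_⟩
  · simp only [trfB]; ring
  · simp only [trfC]; ring
  · simp only [trfD]; linarith

end

/-- Duhamel's formula for the difference of the gaps of two systems. -/
theorem gap_sub_gap (h : IsPeriodicSystem a b) (h' : IsPeriodicSystem a' b') (r : ℝ) :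
    gap a b r - gap a' b' r = ∫ x in (0 : ℝ)..1,
      (gapVarB a b a' b' r (r + x) * (b (r + x) - b' (r + x)) +
        gapVarA a b a' b' r (r + x) * (a (r + x) - a' (r + x))) := by
  have hc : Continuous fun s => gapVarB a b a' b' r s * (b s - b' s) +
      gapVarA a b a' b' r s * (a s - a' s) := by
    have c1 := h.continuous_phi₁
    have c2 := h.continuous_phi₂
    have c3 := h.continuous_psi₁
    have c4 := h.continuous_psi₂
    have c5 := h'.continuous_phi₁
    have c6 := h'.continuous_phi₂
    have c7 := h'.continuous_psi₁
    have c8 := h'.continuous_psi₂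
    have c9 := h.continuous_left
    have c10 := h.continuous_right
    have c11 := h'.continuous_left
    have c12 := h'.continuous_right
    unfold gapVarB gapVarA trfA trfB trfC trfD
    fun_prop
  -- The trace of `diag(-1,1) T'(r+1,s) T(s,r)` interpolates from the gap of the second system at `s
  -- = r` to that of the first at `s = r + 1`.
  have hd : ∀ s, HasDerivAt (fun s =>
      -(trfA a' b' (r + 1) s * trfA a b s r + trfB a' b' (r + 1) s * trfC a b s r) +
      (trfC a' b' (r + 1) s * trfB a b s r + trfD a' b' (r + 1) s * trfD a b s r))
      (gapVarB a b a' b' r s * (b s - b' s) + gapVarA a b a' b' r s * (a s - a' s)) s := fun s => by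
    obtain ⟨l1, l2, l3, l4⟩ := h.hasDerivAt_trf_left s r
    obtain ⟨r1, r2, r3, r4⟩ := h'.hasDerivAt_trf_right (r + 1) s
    refine (((r1.mul l1).add (r2.mul l3)).neg.add ((r3.mul l2).add (r4.mul l4))).congr_deriv ?_
    simp only [gapVarA, gapVarB]
    ring
  have hFTC := intervalIntegral.integral_eq_sub_of_hasDerivAt (a := r) (b := r + 1)
    (fun s _ => hd s) (hc.intervalIntegrable _ _)
  obtain ⟨e1, e2, e3, e4⟩ := h.trf_self r
  obtain ⟨e5, e6, e7, e8⟩ := h'.trf_self (r + 1)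
  rw [e1, e2, e3, e4, e5, e6, e7, e8] at hFTC
  have hshift := intervalIntegral.integral_comp_add_left (a := 0) (b := 1)
    (fun s => gapVarB a b a' b' r s * (b s - b' s) + gapVarA a b a' b' r s * (a s - a' s)) r
  rw [add_zero] at hshift
  rw [hshift, hFTC]
  simp only [gap, monA, monD, trfA, trfD]
  ring

section

variable (h : IsPeriodicSystem a b)
include h

/-- The matrix `W(s) = T(s,r) diag(-1,1) T(r+1,s)` satisfies `W' = N W - W N`, so both off-diagonal
derivatives involve the same `e = W₂₂ - W₁₁`. -/
theorem hasDerivAt_gapVar (r s : ℝ) : ∃ e : ℝ,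
    HasDerivAt (gapVarB a b a b r) (a s * e) s ∧ HasDerivAt (gapVarA a b a b r) (-(b s * e)) s := by
  obtain ⟨l1, l2, l3, l4⟩ := h.hasDerivAt_trf_left s r
  obtain ⟨r1, r2, r3, r4⟩ := h.hasDerivAt_trf_right (r + 1) s
  refine ⟨trfD a b s r * trfD a b (r + 1) s - trfC a b s r * trfB a b (r + 1) s +
    trfA a b s r * trfA a b (r + 1) s - trfB a b s r * trfC a b (r + 1) s, ?_, ?_⟩
  · exact ((l2.mul r4).sub (l1.mul r2)).congr_deriv (by ring)
  · exact ((l4.mul r3).sub (l3.mul r1)).congr_deriv (by ring)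

theorem continuous_gapVar (r : ℝ) :
    Continuous (gapVarB a b a b r) ∧ Continuous (gapVarA a b a b r) := by
  constructor <;> refine continuous_iff_continuousAt.2 fun s => ?_
  · obtain ⟨_, h1, _⟩ := h.hasDerivAt_gapVar r s
    exact h1.continuousAt
  · obtain ⟨_, _, h1⟩ := h.hasDerivAt_gapVar r s
    exact h1.continuousAt

theorem gapVar_endpoints (r : ℝ) :
    gapVarB a b a b r r = -monB a b r ∧ gapVarA a b a b r r = monC a b r ∧
    gapVarB a b a b r (r + 1) = monB a b r := by
  obtain ⟨e1, e2, e3, e4⟩ := h.trf_self r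
  obtain ⟨-, e6, -, e8⟩ := h.trf_self (r + 1)
  simp only [gapVarA, gapVarB, e1, e2, e3, e4, e6, e8]
  simp only [trfB, trfC, monB, monC]
  refine ⟨?_, ?_, ?_⟩ <;> ring

/-- Equal diagonal entries are half the trace, hence exceed 1, and `BC = A² - 1`. -/
theorem monB_mul_monC_pos (ht : 2 < trc a b) {r : ℝ} (hr : gap a b r = 0) :
    0 < monB a b r * monC a b r := by
  have h1 := h.monA_add_monD r
  have h2 := h.mon_det r
  simp only [gap] at hr
  have h3 : monD a b r = monA a b r := by linarith
  rw [h3] at h1 h2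
  nlinarith

/-- At a zero of the gap the variations with respect to `a` and `b` are not proportional to
`b` and `a`. -/
theorem exists_gapVar_ne (ht : 2 < trc a b) {r : ℝ} (hr : gap a b r = 0) :
    ∃ x ∈ Ioo (0 : ℝ) 1, b (r + x) * gapVarB a b a b r (r + x) -
      a (r + x) * gapVarA a b a b r (r + x) ≠ 0 := by
  by_contra! hzero
  obtain ⟨e1, e2, e3⟩ := h.gapVar_endpoints r
  have hpos := h.monB_mul_monC_pos ht hr
  obtain ⟨cB, cA⟩ := h.continuous_gapVar r
  -- The product has derivative `-e (b gapVarB - a gapVarA)`, which vanishes under the contrary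
  -- assumption.
  have hconst : ∀ s ∈ Icc r (r + 1), gapVarB a b a b r s * gapVarA a b a b r s =
      gapVarB a b a b r r * gapVarA a b a b r r := by
    intro s hs
    rcases hs.1.eq_or_lt with rfl | hrs
    · rfl
    obtain ⟨y, hy, hy'⟩ := exists_deriv_eq_slope
      (fun s => gapVarB a b a b r s * gapVarA a b a b r s) hrs (cB.mul cA).continuousOn
      fun y _ => by
        obtain ⟨_, h1, h2⟩ := h.hasDerivAt_gapVar r y
        exact (h1.mul h2).differentiableAt.differentiableWithinAt
    obtain ⟨e, h1, h2⟩ := h.hasDerivAt_gapVar r y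
    have hz := hzero (y - r) ⟨by linarith [hy.1], by linarith [hy.2, hs.2]⟩
    rw [add_sub_cancel] at hz
    have hd0 : deriv (fun s => gapVarB a b a b r s * gapVarA a b a b r s) y = 0 := by
      refine (h1.mul h2).deriv.trans ?_
      linear_combination (-e) * hz
    rw [hd0, eq_comm, div_eq_zero_iff, or_iff_left (by linarith)] at hy'
    linarith
  -- The end values of `gapVarB` are `-B` and `B`, so it has a zero, where the constant product
  -- cannot equal `-BC ≠ 0`.
  have h0 : (0 : ℝ) ∈ uIcc (gapVarB a b a b r r) (gapVarB a b a b r (r + 1)) := by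
    rw [e1, e3, mem_uIcc]
    rcases le_total 0 (monB a b r) with hm | hm
    · exact Or.inl ⟨by linarith, hm⟩
    · exact Or.inr ⟨hm, by linarith⟩
  obtain ⟨s, hs, hs0⟩ := intermediate_value_uIcc cB.continuousOn h0
  rw [uIcc_of_le (by linarith)] at hs
  have := hconst s hs
  rw [hs0, zero_mul, e1, e2] at this
  linarith

end

end IsPeriodicSystem

/-! ### From the first variation to density of simple gap zeros. -/

/-- Density of the parameters for which all zeros of the gap are simple, if at each zero the
coefficients can be moved in a direction along which the gap has a non-zero derivative. -/
theorem mem_closure_simple_gap_zeros {E : Type*} [NormedAddCommGroup E] [NormedSpace ℝ E]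
    {X : Set E} (hX : IsOpen X) {a b : E → ℝ → ℝ}
    (ha : Continuous fun q : X × ℝ => a q.1 q.2) (hb : Continuous fun q : X × ℝ => b q.1 q.2)
    (hsys : ∀ θ ∈ X, IsPeriodicSystem (a θ) (b θ))
    (hdir : ∀ θ₀ : X, ∀ r ∈ Icc (0 : ℝ) 1, gap (a θ₀) (b θ₀) r = 0 →
      ∃ (φ : E) (qa qb : X → X → ℝ → ℝ),
        Continuous (fun q : (X × X) × ℝ => qa q.1.1 q.1.2 q.2) ∧
        Continuous (fun q : (X × X) × ℝ => qb q.1.1 q.1.2 q.2) ∧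
        (∀ (θ θ' : X) (t : ℝ), (θ' : E) = θ + t • φ → ∀ s,
          a θ' s - a θ s = t * qa θ θ' s ∧ b θ' s - b θ s = t * qb θ θ' s) ∧
        ∫ x in (0 : ℝ)..1, (gapVarB (a θ₀) (b θ₀) (a θ₀) (b θ₀) r (r + x) * qb θ₀ θ₀ (r + x) +
          gapVarA (a θ₀) (b θ₀) (a θ₀) (b θ₀) r (r + x) * qa θ₀ θ₀ (r + x)) ≠ 0)
    {θ : E} (hθ : θ ∈ X) :
    θ ∈ closure {θ' ∈ X | ∀ r ∈ Icc (0 : ℝ) 1, gap (a θ') (b θ') r = 0 →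
      2 * (b θ' r * monB (a θ') (b θ') r - a θ' r * monC (a θ') (b θ') r) ≠ 0} := by
  have hemb : IsOpenEmbedding (Prod.map Subtype.val id : X × ℝ → E × ℝ) :=
    hX.isOpenEmbedding_subtypeVal.prodMap .id
  have hcont : ∀ g : E × ℝ → ℝ, Continuous (fun q : X × ℝ => g (q.1, q.2)) →
      ContinuousOn g (X ×ˢ univ) := fun g hg q hq =>
    (hemb.continuousAt_iff (g := g) (x := (⟨q.1, hq.1⟩, q.2))).1 hg.continuousAt
      |>.continuousWithinAt
  have c1 := continuous_phi₁_uncurry (a := fun θ : X => a θ) (b := fun θ : X => b θ) ha hb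
  have c2 := continuous_phi₂_uncurry (a := fun θ : X => a θ) (b := fun θ : X => b θ) ha hb
  have c3 := continuous_psi₁_uncurry (a := fun θ : X => a θ) (b := fun θ : X => b θ) ha hb
  have c4 := continuous_psi₂_uncurry (a := fun θ : X => a θ) (b := fun θ : X => b θ) ha hb
  have s1 := c1.comp (by fun_prop : Continuous fun q : X × ℝ => (q.1, q.2 + 1))
  have s2 := c2.comp (by fun_prop : Continuous fun q : X × ℝ => (q.1, q.2 + 1))
  have s3 := c3.comp (by fun_prop : Continuous fun q : X × ℝ => (q.1, q.2 + 1))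
  have s4 := c4.comp (by fun_prop : Continuous fun q : X × ℝ => (q.1, q.2 + 1))
  have cA := (s1.mul c4).sub (s2.mul c3)
  have cB := (s2.mul c1).sub (s1.mul c2)
  have cC := (s3.mul c4).sub (s4.mul c3)
  have cD := (s4.mul c1).sub (s3.mul c2)
  refine mem_closure_simple_zeros hX (F := fun θ => gap (a θ) (b θ))
    (hcont _ (cD.sub cA)) (hcont _ (((hb.mul cB).sub (ha.mul cC)).const_mul 2))
    (fun θ hθ r => (hsys θ hθ).hasDerivAt_gap r) (fun θ₀ hθ₀ r hr h0 => ?_) hθ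
  obtain ⟨φ, qa, qb, hqa, hqb, hq, hne⟩ := hdir ⟨θ₀, hθ₀⟩ r hr h0
  -- By Duhamel `J` is the exact difference quotient of the gap along `φ`. It is continuous and
  -- non-zero at `(θ₀, θ₀, r)`, so half its absolute value there is a uniform speed nearby; the gap
  -- need not be differentiated in the parameter.
  set J : (X × X) × ℝ → ℝ := fun q => ∫ x in (0 : ℝ)..1,
    (gapVarB (a q.1.2) (b q.1.2) (a q.1.1) (b q.1.1) q.2 (q.2 + x) * qb q.1.1 q.1.2 (q.2 + x) +
      gapVarA (a q.1.2) (b q.1.2) (a q.1.1) (b q.1.1) q.2 (q.2 + x) * qa q.1.1 q.1.2 (q.2 + x))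
    with hJ
  have cJ : Continuous J := by
    refine intervalIntegral.continuous_parametric_intervalIntegral_of_continuous' ?_ 0 1
    have hl : ∀ g : X × ℝ → ℝ, Continuous g → ∀ T : ((X × X) × ℝ) × ℝ → ℝ, Continuous T →
        Continuous fun q : ((X × X) × ℝ) × ℝ => g (q.1.1.1, T q) := fun g hg T hT =>
      hg.comp (by fun_prop)
    have hr : ∀ g : X × ℝ → ℝ, Continuous g → ∀ T : ((X × X) × ℝ) × ℝ → ℝ, Continuous T →
        Continuous fun q : ((X × X) × ℝ) × ℝ => g (q.1.1.2, T q) := fun g hg T hT =>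
      hg.comp (by fun_prop)
    have t0 : Continuous fun q : ((X × X) × ℝ) × ℝ => q.1.2 := by fun_prop
    have t1 : Continuous fun q : ((X × X) × ℝ) × ℝ => q.1.2 + q.2 := by fun_prop
    have t2 : Continuous fun q : ((X × X) × ℝ) × ℝ => q.1.2 + 1 := by fun_prop
    have k1 := hqa.comp
      (by fun_prop : Continuous fun q : ((X × X) × ℝ) × ℝ => (q.1.1, q.1.2 + q.2))
    have k2 := hqb.comp
      (by fun_prop : Continuous fun q : ((X × X) × ℝ) × ℝ => (q.1.1, q.1.2 + q.2))
    have uA := ((hr _ c1 _ t1).mul (hr _ c4 _ t0)).sub ((hr _ c2 _ t1).mul (hr _ c3 _ t0))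
    have uB := ((hr _ c2 _ t1).mul (hr _ c1 _ t0)).sub ((hr _ c1 _ t1).mul (hr _ c2 _ t0))
    have uC := ((hr _ c3 _ t1).mul (hr _ c4 _ t0)).sub ((hr _ c4 _ t1).mul (hr _ c3 _ t0))
    have uD := ((hr _ c4 _ t1).mul (hr _ c1 _ t0)).sub ((hr _ c3 _ t1).mul (hr _ c2 _ t0))
    have wA := ((hl _ c1 _ t2).mul (hl _ c4 _ t1)).sub ((hl _ c2 _ t2).mul (hl _ c3 _ t1))
    have wB := ((hl _ c2 _ t2).mul (hl _ c1 _ t1)).sub ((hl _ c1 _ t2).mul (hl _ c2 _ t1))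
    have wC := ((hl _ c3 _ t2).mul (hl _ c4 _ t1)).sub ((hl _ c4 _ t2).mul (hl _ c3 _ t1))
    have wD := ((hl _ c4 _ t2).mul (hl _ c1 _ t1)).sub ((hl _ c3 _ t2).mul (hl _ c2 _ t1))
    exact (((uB.mul wD).sub (uA.mul wB)).mul k2).add (((uD.mul wC).sub (uC.mul wA)).mul k1)
  set p₀ : (X × X) × ℝ := ((⟨θ₀, hθ₀⟩, ⟨θ₀, hθ₀⟩), r)
  have hJ0 : 0 < |J p₀| := abs_pos.2 hne
  have hev : ∀ᶠ q in 𝓝 p₀, |J p₀| / 2 < |J q| :=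
    continuousAt_const.eventually_lt cJ.abs.continuousAt (half_lt_self hJ0)
  have hemb2 : IsOpenEmbedding (Prod.map (Prod.map Subtype.val Subtype.val) id :
      (X × X) × ℝ → (E × E) × ℝ) :=
    (hX.isOpenEmbedding_subtypeVal.prodMap hX.isOpenEmbedding_subtypeVal).prodMap .id
  refine ⟨φ, |J p₀| / 2, half_pos hJ0, ?_⟩
  have hmap : 𝓝 ((θ₀, θ₀), r) = map (Prod.map (Prod.map Subtype.val Subtype.val) id) (𝓝 p₀) :=
    (hemb2.map_nhds_eq p₀).symm
  rw [hmap, eventually_map]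
  filter_upwards [hev] with q hqJ t ht
  have hgap : gap (a q.1.2) (b q.1.2) q.2 - gap (a q.1.1) (b q.1.1) q.2 = t * J q := by
    rw [(hsys _ q.1.2.2).gap_sub_gap (hsys _ q.1.1.2), hJ, ← intervalIntegral.integral_const_mul]
    refine intervalIntegral.integral_congr fun x _ => ?_
    obtain ⟨h1, h2⟩ := hq q.1.1 q.1.2 t ht (q.2 + x)
    simp only [h1, h2]
    ring
  simp only [Prod.map_fst, Prod.map_snd, id]
  rw [hgap, abs_mul, mul_comm]
  gcongr

/-! ### Periodic bump functions as test directions. -/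

/-- The cosine depends only on the distance from `y` to the integers and decreases in it. This
confines the support of the bumps modulo 1. -/
theorem cos_two_pi_mul_le {μ y : ℝ} (hμ : 0 ≤ μ) (h1 : μ ≤ |y|) (h2 : |y| ≤ 1 - μ) :
    Real.cos (2 * Real.pi * y) ≤ Real.cos (2 * Real.pi * μ) := by
  have hpi := Real.pi_pos
  have habs : Real.cos (2 * Real.pi * y) = Real.cos (2 * Real.pi * |y|) := by
    rw [← Real.cos_abs, abs_mul, abs_of_pos (by positivity)]
  rw [habs]
  rcases le_total |y| (1 / 2) with h | h
  · exact Real.cos_le_cos_of_nonneg_of_le_pi (by positivity) (by nlinarith) (by nlinarith)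
  · have e : Real.cos (2 * Real.pi * |y|) = Real.cos (2 * Real.pi * (1 - |y|)) := by
      rw [← Real.cos_two_pi_sub]
      congr 1
      ring
    rw [e]
    exact Real.cos_le_cos_of_nonneg_of_le_pi (by positivity) (by nlinarith) (by nlinarith)

/-- A smooth 1-periodic function that is positive exactly where `cos (2π(s - s₀)) > c`. -/
def bump (s₀ c : ℝ) : PerC2 :=
  ⟨fun s => Real.smoothTransition (Real.cos (2 * Real.pi * (s - s₀)) - c),
    Real.smoothTransition.contDiff.comp (by fun_prop), fun s => by
      have e : 2 * Real.pi * (s + 1 - s₀) = 2 * Real.pi * (s - s₀) + 2 * Real.pi := by ring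
      simp only [e, Real.cos_add_two_pi]⟩

theorem bump_apply (s₀ c s : ℝ) :
    bump s₀ c s = Real.smoothTransition (Real.cos (2 * Real.pi * (s - s₀)) - c) := rfl

/-- A continuous function on `(0,1)` that does not vanish identically is detected by a periodic
`C²` function. -/
theorem exists_perC2_integral_ne_zero {w : ℝ → ℝ} (hw : Continuous w) {x₀ : ℝ}
    (hx₀ : x₀ ∈ Ioo (0 : ℝ) 1) (hne : w x₀ ≠ 0) (r : ℝ) :
    ∃ φ : PerC2, ∫ x in (0 : ℝ)..1, φ (r + x) * w x ≠ 0 := by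
  have hpos : ∀ w : ℝ → ℝ, Continuous w → 0 < w x₀ →
      ∃ φ : PerC2, 0 < ∫ x in (0 : ℝ)..1, φ (r + x) * w x := by
    intro w hw h0
    have hev : ∀ᶠ x in 𝓝 x₀, 0 < w x ∧ x ∈ Ioo (0 : ℝ) 1 :=
      (continuousAt_const.eventually_lt hw.continuousAt h0).and (isOpen_Ioo.mem_nhds hx₀)
    obtain ⟨μ, hμ, hμw⟩ := Metric.nhds_basis_closedBall.eventually_iff.1 hev
    have hl := (hμw (x := x₀ - μ) (by simp [abs_of_pos hμ])).2.1
    have hr := (hμw (x := x₀ + μ) (by simp [abs_of_pos hμ])).2.2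
    refine ⟨bump (r + x₀) (Real.cos (2 * Real.pi * μ)), ?_⟩
    have hφ : ∀ x, bump (r + x₀) (Real.cos (2 * Real.pi * μ)) (r + x) =
        Real.smoothTransition (Real.cos (2 * Real.pi * (x - x₀)) - Real.cos (2 * Real.pi * μ)) :=
      fun x => by rw [bump_apply, add_sub_add_left_eq_sub]
    have hcont : Continuous fun x => bump (r + x₀) (Real.cos (2 * Real.pi * μ)) (r + x) * w x :=
      ((PerC2.continuous _).comp (by fun_prop)).mul hw
    have := intervalIntegral.integral_lt_integral_of_continuousOn_of_le_of_exists_lt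
      (f := fun _ => (0 : ℝ)) zero_lt_one continuousOn_const hcont.continuousOn (fun x hx => ?_)
      ⟨x₀, Ioo_subset_Icc_self hx₀, ?_⟩
    · simpa using this
    · rcases le_or_gt |x - x₀| μ with h | h
      · exact mul_nonneg (by rw [hφ]; exact Real.smoothTransition.nonneg _)
          (hμw (by rwa [Metric.mem_closedBall, Real.dist_eq])).1.le
      -- Since `[x₀ - μ, x₀ + μ] ⊆ (0,1)`, the neighbouring periodic copies of the bump do not reach
      -- `[0,1]`.
      · have h2 : |x - x₀| ≤ 1 - μ := abs_le.2 ⟨by linarith [hx.1], by linarith [hx.2]⟩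
        rw [hφ, Real.smoothTransition.zero_of_nonpos
          (sub_nonpos.2 (cos_two_pi_mul_le hμ.le h.le h2)), zero_mul]
    · refine mul_pos ?_ h0
      rw [hφ, sub_self, mul_zero, Real.cos_zero]
      refine Real.smoothTransition.pos_of_pos (sub_pos.2 ?_)
      rw [← Real.cos_zero]
      have hpi := Real.pi_pos
      have hμ2 : μ < 1 / 2 := by linarith
      exact Real.cos_lt_cos_of_nonneg_of_le_pi le_rfl (by nlinarith) (by positivity)
  rcases hne.lt_or_gt with h | h
  · obtain ⟨φ, hφ⟩ := hpos (fun x => -w x) hw.neg (neg_pos.2 h)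
    refine ⟨φ, fun h0 => ?_⟩
    simp only [mul_neg, intervalIntegral.integral_neg, h0, neg_zero, lt_irrefl] at hφ
  · obtain ⟨φ, hφ⟩ := hpos w hw h
    exact ⟨φ, hφ.ne'⟩

/-! ### Density when `f` varies and when `κ` varies. -/

section

variable {n : ℕ}

/-- Density of the non-degenerate case when the warping function varies. -/
theorem mem_closure_nondegenerate_left (hn : 1 ≤ n) {f κ : PerC2} (hf : IsPositive f)
    (hc : IsCoercive n f κ) :
    f ∈ closure {g : PerC2 | AllCriticalPointsNondegenerate (potential n g κ)} := by
  set X : Set PerC2 := (fun g => (g, κ)) ⁻¹' coercivePairs n with hXdef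
  have hX : IsOpen X := (isOpen_coercivePairs n).preimage (by fun_prop)
  have cf : Continuous fun q : X × ℝ => (q.1 : PerC2) q.2 :=
    PerC2.continuous_eval.comp (by fun_prop : Continuous fun q : X × ℝ => ((q.1 : PerC2), q.2))
  have cκ : Continuous fun q : X × ℝ => κ q.2 := κ.continuous.comp continuous_snd
  have hfX : f ∈ X := ⟨hf, hc⟩
  have hden := mem_closure_simple_gap_zeros hX (a := fun g => coefA n g)
    (b := fun g => coefB n g κ)
    (continuous_const.div (cf.pow n) fun q => (q.1.2.1.pow_pos n q.2).ne')
    ((cf.pow n).mul cκ) (fun g hg => hg.1.isPeriodicSystem n κ) (fun g r _ h0 => ?_) hfX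
  · exact closure_mono (fun g hg => hg.1.1.allCriticalPointsNondegenerate hg.1.2 hg.2) hden
  have hg := g.2.1
  have hsys := hg.isPeriodicSystem n κ
  obtain ⟨x₀, hx₀, hne⟩ := hsys.exists_gapVar_ne (g.2.2.two_lt_trc hg) h0
  obtain ⟨cB, cA⟩ := hsys.continuous_gapVar r
  have cg := (g : PerC2).continuous
  have ca := hsys.continuous_left
  have cb := hsys.continuous_right
  have hn0 : (n : ℝ) ≠ 0 := by exact_mod_cast (by omega : n ≠ 0)
  -- The weight is the first variation in `f`: a change `φ` of `f` changes `b` by `n b φ / f` and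
  -- `a` by `-n a φ / f`.
  obtain ⟨φ, hφ⟩ := exists_perC2_integral_ne_zero
    (w := fun x => n / (g : PerC2) (r + x) *
      (coefB n g κ (r + x) *
        gapVarB (coefA n g) (coefB n g κ) (coefA n g) (coefB n g κ) r (r + x) -
      coefA n g (r + x) *
        gapVarA (coefA n g) (coefB n g κ) (coefA n g) (coefB n g κ) r (r + x)))
    (Continuous.mul (continuous_const.div (by fun_prop) fun x => (hg.pos _).ne') (by fun_prop))
    hx₀ (mul_ne_zero (div_ne_zero hn0 (hg.pos _).ne') hne) r
  -- The divided difference of `x ↦ xⁿ`, written as a polynomial so that it stays continuous at `g =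
  -- g'`, where it equals `n gⁿ⁻¹`.
  set S : X → X → ℝ → ℝ := fun g g' s =>
    ∑ i ∈ Finset.range n, (g' : PerC2) s ^ i * (g : PerC2) s ^ (n - 1 - i) with hS
  have l1 : Continuous fun q : (X × X) × ℝ => (q.1.1 : PerC2) q.2 :=
    PerC2.continuous_eval.comp
      (by fun_prop : Continuous fun q : (X × X) × ℝ => ((q.1.1 : PerC2), q.2))
  have l2 : Continuous fun q : (X × X) × ℝ => (q.1.2 : PerC2) q.2 :=
    PerC2.continuous_eval.comp
      (by fun_prop : Continuous fun q : (X × X) × ℝ => ((q.1.2 : PerC2), q.2))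
  have lφ : Continuous fun q : (X × X) × ℝ => φ q.2 := φ.continuous.comp continuous_snd
  have lκ : Continuous fun q : (X × X) × ℝ => κ q.2 := κ.continuous.comp continuous_snd
  have lS : Continuous fun q : (X × X) × ℝ => S q.1.1 q.1.2 q.2 :=
    continuous_finsetSum _ fun i _ => (l2.pow _).mul (l1.pow _)
  refine ⟨φ, fun g g' s => -(φ s * S g g' s) * (coefA n g s * coefA n g' s),
    fun g g' s => φ s * S g g' s * κ s, (lφ.mul lS).neg.mul
      ((continuous_const.div (l1.pow n) fun q => (q.1.1.2.1.pow_pos n q.2).ne').mul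
        (continuous_const.div (l2.pow n) fun q => (q.1.2.2.1.pow_pos n q.2).ne')),
    (lφ.mul lS).mul lκ, fun g g' t ht s => ?_, ?_⟩
  · have e1 : (g' : PerC2) s = (g : PerC2) s + t * φ s := by rw [ht]; rfl
    have e2 : (g' : PerC2) s ^ n - (g : PerC2) s ^ n = t * (φ s * S g g' s) := by
      have := (Commute.all ((g' : PerC2) s) ((g : PerC2) s)).mul_geom_sum₂ n
      rw [← this, e1]
      simp only [hS, e1]
      ring
    have p1 := (g.2.1.pow_pos n s).ne'
    have p2 := (g'.2.1.pow_pos n s).ne'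
    constructor
    · simp only [coefA]
      field_simp
      linear_combination -e2
    · simp only [coefB]
      linear_combination κ s * e2
  · convert hφ using 1
    refine intervalIntegral.integral_congr fun x _ => ?_
    have p1 := (hg.pos (r + x)).ne'
    have e3 : S g g (r + x) = n * (g : PerC2) (r + x) ^ n / (g : PerC2) (r + x) := by
      have : ∀ i ∈ Finset.range n, (g : PerC2) (r + x) ^ i * (g : PerC2) (r + x) ^ (n - 1 - i) =
          (g : PerC2) (r + x) ^ n / (g : PerC2) (r + x) := fun i hi => by
        rw [eq_div_iff p1, ← pow_add, ← pow_succ]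
        congr 1
        have := Finset.mem_range.1 hi
        omega
      simp only [hS]
      rw [Finset.sum_congr rfl this, Finset.sum_const, Finset.card_range, nsmul_eq_mul]
      ring
    simp only [e3, coefB, coefA]
    field_simp
    ring

/-- Density of the non-degenerate case when the potential term varies. -/
theorem mem_closure_nondegenerate_right {f κ : PerC2} (hf : IsPositive f)
    (hc : IsCoercive n f κ) :
    κ ∈ closure {k : PerC2 | AllCriticalPointsNondegenerate (potential n f k)} := by
  set X : Set PerC2 := (fun k => (f, k)) ⁻¹' coercivePairs n with hXdef
  have hX : IsOpen X := (isOpen_coercivePairs n).preimage (by fun_prop)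
  have cκ : Continuous fun q : X × ℝ => (q.1 : PerC2) q.2 :=
    PerC2.continuous_eval.comp (by fun_prop : Continuous fun q : X × ℝ => ((q.1 : PerC2), q.2))
  have cp : Continuous fun s => f s ^ n := f.continuous.pow n
  have hκX : κ ∈ X := ⟨hf, hc⟩
  have hden := mem_closure_simple_gap_zeros hX (a := fun _ => coefA n f)
    (b := fun k => coefB n f k)
    ((hf.isPeriodicSystem n κ).continuous_left.comp continuous_snd)
    ((cp.comp continuous_snd).mul cκ) (fun k _ => hf.isPeriodicSystem n k) (fun k r _ h0 => ?_) hκX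
  · exact closure_mono (fun k hk => hf.allCriticalPointsNondegenerate hk.1.2 hk.2) hden
  have hsys := hf.isPeriodicSystem n k
  obtain ⟨cB, -⟩ := hsys.continuous_gapVar r
  set w : ℝ → ℝ := fun x =>
    f (r + x) ^ n * gapVarB (coefA n f) (coefB n f k) (coefA n f) (coefB n f k) r (r + x) with hw
  have cf := f.continuous
  have cw : Continuous w := by fun_prop
  -- The weight at `x = 0` is `-fⁿ B ≠ 0`; continuity then provides a point of `(0,1)` where it is
  -- non-zero.
  have hw0 : w 0 ≠ 0 := by
    have hpos := hsys.monB_mul_monC_pos (k.2.2.two_lt_trc hf) h0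
    simp only [hw, add_zero, (hsys.gapVar_endpoints r).1]
    exact mul_ne_zero (hf.pow_pos n r).ne' (neg_ne_zero.2 (left_ne_zero_of_mul hpos.ne'))
  obtain ⟨x₀, hne, hx₀⟩ := (((cw.continuousAt.eventually_ne hw0).filter_mono
    nhdsWithin_le_nhds).and (Ioo_mem_nhdsGT (one_pos (α := ℝ)))).exists
  obtain ⟨φ, hφ⟩ := exists_perC2_integral_ne_zero cw hx₀ hne r
  refine ⟨φ, fun _ _ _ => 0, fun _ _ s => f s ^ n * φ s, continuous_const,
    (cp.mul φ.continuous).comp continuous_snd, fun k k' t ht s => ⟨by simp, ?_⟩, ?_⟩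
  · have e1 : (k' : PerC2) s = (k : PerC2) s + t * φ s := by rw [ht]; rfl
    simp only [coefB, e1]
    ring
  · convert hφ using 1
    refine intervalIntegral.integral_congr fun x _ => ?_
    simp only [hw]
    ring

end

/-- A property that is dense in the whole of an open ball is dense relative to the closed ball. -/
theorem closedBall_subset_closure_sep {E : Type*} [NormedAddCommGroup E] [NormedSpace ℝ E]
    {x : E} {ρ : ℝ} (hρ : 0 < ρ) {P : E → Prop}
    (h : ∀ y ∈ Metric.closedBall x ρ, y ∈ closure {z | P z}) :
    Metric.closedBall x ρ ⊆ closure {y ∈ Metric.closedBall x ρ | P y} := by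
  -- Near a boundary point of the closed ball approximants could fall outside. Hence open-ball
  -- points are approximated first, and the closure is taken afterwards.
  rw [← closure_ball x hρ.ne']
  refine closure_minimal (fun y hy => mem_closure_iff.2 fun O hO hyO => ?_) isClosed_closure
  obtain ⟨z, ⟨h1, h2⟩, h3⟩ := mem_closure_iff.1 (h y (Metric.ball_subset_closedBall hy))
    (O ∩ Metric.ball x ρ) (hO.inter Metric.isOpen_ball) ⟨hyO, hy⟩
  exact ⟨z, h1, subset_closure h2, h3⟩

end WarpedGreen

end

open WarpedGreen in
theorem theorem1p1 (n : ℕ) (hn : 1 ≤ n) :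
    (∀ f₀ κ : PerC2, IsPositive f₀ → IsCoercive n f₀ κ →
      ∃ ρ₀ : ℝ, 0 < ρ₀ ∧ ∀ ρ : ℝ, 0 < ρ → ρ ≤ ρ₀ →
        (∀ f ∈ Metric.closedBall f₀ ρ, IsAdmissible n f κ) ∧
        Metric.closedBall f₀ ρ ⊆ closure {f ∈ Metric.closedBall f₀ ρ |
          AllCriticalPointsNondegenerate (potential n f κ)}) ∧
    (∀ f κ₀ : PerC2, IsPositive f → IsCoercive n f κ₀ →
      ∃ ρ₀ : ℝ, 0 < ρ₀ ∧ ∀ ρ : ℝ, 0 < ρ → ρ ≤ ρ₀ →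
        (∀ κ ∈ Metric.closedBall κ₀ ρ, IsAdmissible n f κ) ∧
        Metric.closedBall κ₀ ρ ⊆ closure {κ ∈ Metric.closedBall κ₀ ρ |
          AllCriticalPointsNondegenerate (potential n f κ)}) := by
  constructor
  · intro f₀ κ hf hc
    -- Openness supplies `ρ₀`: a closed ball inside the set of parameters that are positive and
    -- coercive.
    have hX : (fun g => (g, κ)) ⁻¹' coercivePairs n ∈ nhds f₀ :=
      ((isOpen_coercivePairs n).preimage (by fun_prop)).mem_nhds ⟨hf, hc⟩
    obtain ⟨ρ₀, hρ₀, hball⟩ := Metric.nhds_basis_closedBall.mem_iff.1 hX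
    refine ⟨ρ₀, hρ₀, fun ρ hρ hle => ?_⟩
    have hsub := fun g (hg : g ∈ Metric.closedBall f₀ ρ) =>
      hball (Metric.closedBall_subset_closedBall hle hg)
    exact ⟨fun g hg => (hsub g hg).1.isAdmissible (hsub g hg).2,
      closedBall_subset_closure_sep hρ fun g hg =>
        mem_closure_nondegenerate_left hn (hsub g hg).1 (hsub g hg).2⟩
  · intro f κ₀ hf hc
    have hX : (fun k => (f, k)) ⁻¹' coercivePairs n ∈ nhds κ₀ :=
      ((isOpen_coercivePairs n).preimage (by fun_prop)).mem_nhds ⟨hf, hc⟩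
    obtain ⟨ρ₀, hρ₀, hball⟩ := Metric.nhds_basis_closedBall.mem_iff.1 hX
    refine ⟨ρ₀, hρ₀, fun ρ hρ hle => ?_⟩
    have hsub := fun k (hk : k ∈ Metric.closedBall κ₀ ρ) =>
      hball (Metric.closedBall_subset_closedBall hle hk)
    exact ⟨fun k hk => hf.isAdmissible (hsub k hk).2,
      closedBall_subset_closure_sep hρ fun k hk =>
        mem_closure_nondegenerate_right hf (hsub k hk).2⟩
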